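/- For every $\varepsilon>0$ there is a smooth Riemannian metric $g$ on the punctured plane $\mathbf R^2\setminus\{0\}$ with the following properties; write $S_0$ for the resulting surface, $(r,\theta)$ for polar coordinates, $\mathrm{Area}$ for the Riemannian area and $\ell$ for length, i.e. the $1$-dimensional Hausdorff measure of the Riemannian distance. (1) $g=dr^2+r^{-4}\,d\theta^2$ on $\{r\ge 1+\varepsilon\}$, and $g$ is invariant under the inversion $(r,\theta)\mapsto(1/r,\theta)$. (So $g$ is prescribed outside the annulus $1/(1+\varepsilon)<r<1+\varepsilon$ around the unit circle.) (2) $S_0$ is complete and $\mathrm{Area}(S_0)=4\pi$. (3) For every $\rho>1$ the set $\{r\ge\rho\}$ is a smooth subsurface with boundary of $S_0$ with $0<\mathrm{Area}(\{r\ge\rho\})\le \mathrm{Area}(S_0)/2$, and for $\rho\ge 1+\varepsilon$ its isoperimetric ratio $\ell(\partial\{r\ge\rho\})/\mathrm{Area}(\{r\ge\rho\})$ equals $1/\rho$. (4) The Cheeger constant $h(S_0)=\inf_D \ell(\partial D)/\mathrm{Area}(D)$ is $0$, where $D$ ranges over the closed subsets of $S_0$ that are smooth $2$-dimensional submanifolds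 with boundary and satisfy $0<\mathrm{Area}(D)\le\mathrm{Area}(S_0)/2$. (5) $S_0$ has no Cheeger minimizer: there is no measurable subset $A\subseteq S_0$ with $0<\mathrm{Area}(A)\le\mathrm{Area}(S_0)/2$ and $\ell(\partial A)/\mathrm{Area}(A)=h(S_0)$, where $\partial A$ is the topological boundary. -/

import Mathlib

open MeasureTheory Set
open scoped Manifold ContDiff ENNReal Bundle

noncomputable section

namespace Cheeger

/-- The Euclidean plane `ℝ²`. -/
abbrev Plane : Type := EuclideanSpace ℝ (Fin 2)

section General

variable {M : Type} [TopologicalSpace M] [ChartedSpace Plane M] [IsManifold 𝓘(ℝ, Plane) ∞ M]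

variable (M) in
/-- Smooth (`C^∞`) Riemannian metrics on a smooth 2-manifold `M`. -/
abbrev SmoothMetric : Type :=
  Bundle.ContMDiffRiemannianMetric 𝓘(ℝ, Plane) ∞ Plane
    (fun x : M => TangentSpace 𝓘(ℝ, Plane) x)

/-- The metric space structure on `M` given by the Riemannian distance of `g`, that is, the infimum
of the `g`-lengths of `C^1` paths. Its topology is the given topology of `M`. -/
@[reducible] def riemannianEMetricSpace [T3Space M] (g : SmoothMetric M) : EMetricSpace M :=
  letI : Bundle.RiemannianBundle (fun x : M => TangentSpace 𝓘(ℝ, Plane) x) :=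
    ⟨g.toRiemannianMetric⟩
  haveI : IsManifold 𝓘(ℝ, Plane) 1 M := IsManifold.of_le (n := ∞) (by norm_num)
  haveI : IsContinuousRiemannianBundle Plane (fun x : M => TangentSpace 𝓘(ℝ, Plane) x) :=
    ⟨⟨g.inner, g.contMDiff.continuous, fun _ _ _ => rfl⟩⟩
  EMetricSpace.ofRiemannianMetric 𝓘(ℝ, Plane) M

/-- The Riemannian metric `g` is complete: every Cauchy sequence for the Riemannian distance
converges. -/
def IsCompleteMetric [T3Space M] (g : SmoothMetric M) : Prop :=
  letI : EMetricSpace M := riemannianEMetricSpace g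
  CompleteSpace M

/-- Length of subsets: the 1-dimensional Hausdorff measure of the Riemannian distance. -/
def lengthMeasure [T3Space M] [MeasurableSpace M] [BorelSpace M] (g : SmoothMetric M) :
    Measure M :=
  letI : EMetricSpace M := riemannianEMetricSpace g
  Measure.hausdorffMeasure 1

end General

variable {U : TopologicalSpace.Opens Plane}

/-- The value `g_x(v, w)`, for a metric `g` on an open subset `U` of the plane. The tangent space
of `U` at any of its points is the plane itself. -/
def metricAt (g : SmoothMetric U) (x : U) (v w : Plane) : ℝ :=
  g.inner x (v : TangentSpace 𝓘(ℝ, Plane) x) (w : TangentSpace 𝓘(ℝ, Plane) x)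

/-- The Gram matrix `(g_{ij})` of the metric at `x` in the standard coordinates of the plane. -/
def gramMatrix (g : SmoothMetric U) (x : U) : Matrix (Fin 2) (Fin 2) ℝ :=
  Matrix.of fun i j =>
    metricAt g x (EuclideanSpace.single i (1 : ℝ)) (EuclideanSpace.single j (1 : ℝ))

/-- The Riemannian area measure `dA = √det(g_{ij}) dx dy`. -/
def areaMeasure (g : SmoothMetric U) : Measure U :=
  (Measure.comap (Subtype.val : U → Plane) volume).withDensity
    fun x => ENNReal.ofReal (Real.sqrt (gramMatrix g x).det)

/-- The isoperimetric ratio `h*(A) = length(∂A) / Area(A)`. -/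
def isoperimetricRatio (g : SmoothMetric U) (A : Set U) : ℝ≥0∞ :=
  lengthMeasure g (frontier A) / areaMeasure g A

/-- `D` is a smooth 2-dimensional submanifold with boundary of `U`, closed as a subset: near each
of its boundary points, `D` is a sublevel set `{φ ≤ 0}` of a smooth function `φ` with non-vanishing
differential at that point. -/
def IsSmoothDomain (D : Set U) : Prop :=
  IsClosed D ∧ ∀ p ∈ frontier D, ∃ (V : Set Plane) (φ : Plane → ℝ),
    IsOpen V ∧ (p : Plane) ∈ V ∧ ContDiffOn ℝ ∞ φ V ∧ fderiv ℝ φ (p : Plane) ≠ 0 ∧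
      ∀ x : U, (x : Plane) ∈ V → (x ∈ D ↔ φ x ≤ 0)

/-- The smooth subsurfaces over which the Cheeger constant is an infimum. -/
def IsSmoothCandidate (g : SmoothMetric U) (D : Set U) : Prop :=
  IsSmoothDomain D ∧ 0 < areaMeasure g D ∧ areaMeasure g D ≤ areaMeasure g univ / 2

/-- The Cheeger constant `h(U, g)`: the infimum of `length(∂D) / Area(D)` over smooth subsurfaces
`D` with boundary such that `0 < Area(D) ≤ Area(U) / 2`. -/
def cheegerConstant (g : SmoothMetric U) : ℝ≥0∞ :=
  ⨅ (D : Set U) (_ : IsSmoothCandidate g D), isoperimetricRatio g D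

/-- A Cheeger minimizer: a measurable set `A`, with no regularity assumed, of positive area at
most half of the total area, whose isoperimetric ratio is the Cheeger constant. -/
def IsCheegerMinimizer (g : SmoothMetric U) (A : Set U) : Prop :=
  NullMeasurableSet A (areaMeasure g) ∧ 0 < areaMeasure g A ∧
    areaMeasure g A ≤ areaMeasure g univ / 2 ∧
    isoperimetricRatio g A = cheegerConstant g

/-- The punctured plane `ℝ² ∖ {0}`. -/
def puncturedPlane : TopologicalSpace.Opens Plane :=
  ⟨{0}ᶜ, isOpen_compl_singleton⟩

/-- The 1-form `dr` of polar coordinates, at `x` and applied to `v`. -/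
def formDr (x v : Plane) : ℝ := inner ℝ x v / ‖x‖

/-- The 1-form `dθ` of polar coordinates, at `x` and applied to `v`. -/
def formDtheta (x v : Plane) : ℝ := (x 0 * v 1 - x 1 * v 0) / ‖x‖ ^ 2

/-- The metric `dr² + r⁻⁴ dθ²` in polar coordinates, at `x` and applied to `v` and `w`. -/
def modelMetric (x v w : Plane) : ℝ :=
  formDr x v * formDr x w + 1 / ‖x‖ ^ 4 * (formDtheta x v * formDtheta x w)

/-- The inversion `(r, θ) ↦ (1/r, θ)`, that is `x ↦ x / |x|²`, of the punctured plane. -/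
def inv (x : puncturedPlane) : puncturedPlane :=
  ⟨EuclideanGeometry.inversion (0 : Plane) 1 (x : Plane), fun h =>
    x.2 ((EuclideanGeometry.inversion_eq_center one_ne_zero).1 h)⟩

/-- The metric `g` is invariant under the inversion: `inv^* g = g`. -/
def IsInversionInvariant (g : SmoothMetric puncturedPlane) : Prop :=
  ∀ (x : puncturedPlane) (v w : Plane),
    metricAt g (inv x)
      (fderiv ℝ (EuclideanGeometry.inversion (0 : Plane) 1) (x : Plane) v)
      (fderiv ℝ (EuclideanGeometry.inversion (0 : Plane) 1) (x : Plane) w)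
    = metricAt g x v w

/-- The exterior `{|x| ≥ r}` of the circle of Euclidean radius `r`. -/
def exterior (r : ℝ) : Set puncturedPlane := {x | r ≤ ‖(x : Plane)‖}

end Cheeger

end

/-! Put t = log r and consider metrics A(t)² dt² + B(t)² dθ² with A, B smooth and positive. The
model metric has A = exp t and B = exp(-2t). Evenness of A and B is invariance under inversion,
since inversion is t ↦ -t. The area density in (t, θ) is AB, which equals exp(-|t|) outside a
compact range of t. Smoothing it near t = 0 without changing its integral 2 keeps the total area 4π.
If also A ≥ cosh t, then cosh t is a proper 1-Lipschitz function and the metric is complete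
(`exists_profile`, `Profile.isCompleteMetric`).

For large r the circle of radius r has length 2π/r² (`Profile.lengthMeasure_circle`), and its
exterior has area 2π/r (`Profile.areaMeasure_exterior_of_le`). The ratio 1/r tends to 0, so the
Cheeger constant is 0.

A minimizer A would then have a boundary of zero length. Locally Lipschitz functions send such a
boundary to null sets of reals, so almost every circle around the origin and almost every ray misses
it. If A and its complement both had positive area, both would have interior points. A path made of
a piece of a ray, an arc of a circle and a piece of another ray would join these interiors without
meeting the boundary, which is impossible. So A or its complement is null
(`Profile.areaMeasure_eq_zero_of_frontier`), contrary to 0 < Area(A) ≤ Area/2. -/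

noncomputable section

namespace Cheeger

/-! ### Hausdorff measure under locally Lipschitz maps. -/

section Hausdorff

open TopologicalSpace

/-- A locally `K`-Lipschitz map expands the one-dimensional Hausdorff measure by at most `K`. -/
theorem hausdorffMeasure_image_le_of_locally {X Y : Type*} [EMetricSpace X] [MeasurableSpace X]
    [BorelSpace X] [SecondCountableTopology X] [EMetricSpace Y] [MeasurableSpace Y] [BorelSpace Y]
    {f : X → Y} {S : Set X} {K : NNReal}
    (h : ∀ x ∈ S, ∃ s ∈ nhds x, LipschitzOnWith K f (s ∩ S)) :
    Measure.hausdorffMeasure 1 (f '' S) ≤ K * Measure.hausdorffMeasure 1 S := by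
  have h' : ∀ x ∈ S, ∃ s, IsOpen s ∧ x ∈ s ∧ LipschitzOnWith K f (s ∩ S) := fun x hx => by
    obtain ⟨s, hs, hf⟩ := h x hx
    obtain ⟨t, hts, hto, hxt⟩ := mem_nhds_iff.1 hs
    exact ⟨t, hto, hxt, hf.mono (inter_subset_inter_left _ hts)⟩
  choose! s hso hxs hf using h'
  obtain ⟨t, htS, htc, hcov⟩ := countable_cover_nhdsWithin
    (fun x hx => mem_nhdsWithin_of_mem_nhds ((hso x hx).mem_nhds (hxs x hx)))
  rcases S.eq_empty_or_nonempty with rfl | hS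
  · simp
  have htne : t.Nonempty := by
    by_contra hne
    rw [not_nonempty_iff_eq_empty] at hne
    subst hne
    simp at hcov
    exact hS.ne_empty hcov
  obtain ⟨u, rfl⟩ := htc.exists_eq_range htne
  have hu : ∀ n, u n ∈ S := fun n => htS (mem_range_self n)
  -- Disjoint measurable pieces are needed for the measures of the pieces of `S` to add up to that
  -- of `S`. As `S` itself may be non-measurable, additivity is applied to the restricted measure.
  set D : ℕ → Set X := disjointed fun n => s (u n)
  have hDm : ∀ n, MeasurableSet (D n) :=
    MeasurableSet.disjointed fun n => (hso _ (hu n)).measurableSet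
  have hDS : S ⊆ ⋃ n, D n := by
    rw [iUnion_disjointed]
    simpa using hcov
  have hDs : ∀ n, D n ⊆ s (u n) := fun n => disjointed_subset _ n
  calc Measure.hausdorffMeasure 1 (f '' S)
      ≤ Measure.hausdorffMeasure 1 (⋃ n, f '' (D n ∩ S)) := by
        apply measure_mono
        rw [← image_iUnion, ← iUnion_inter]
        exact image_mono fun x hx => ⟨hDS hx, hx⟩
    _ ≤ ∑' n, Measure.hausdorffMeasure 1 (f '' (D n ∩ S)) := measure_iUnion_le _
    _ ≤ ∑' n, K * Measure.hausdorffMeasure 1 (D n ∩ S) := by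
        refine ENNReal.tsum_le_tsum fun n => ?_
        simpa using ((hf _ (hu n)).mono
          (inter_subset_inter_left _ (hDs n))).hausdorffMeasure_image_le zero_le_one
    _ = K * ∑' n, (Measure.hausdorffMeasure 1).restrict S (D n) := by
        rw [ENNReal.tsum_mul_left]
        simp_rw [Measure.restrict_apply (hDm _)]
    _ = K * (Measure.hausdorffMeasure 1).restrict S (⋃ n, D n) := by
        rw [measure_iUnion (disjoint_disjointed _) hDm]
    _ ≤ K * Measure.hausdorffMeasure 1 S := by
        refine mul_le_mul_right ?_ _
        exact (measure_mono (subset_univ _)).trans_eq (Measure.restrict_apply_univ S)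

/-- A locally Lipschitz map sends sets of zero one-dimensional Hausdorff measure to such sets. -/
theorem hausdorffMeasure_image_null_of_locally {X Y : Type*} [EMetricSpace X] [MeasurableSpace X]
    [BorelSpace X] [SecondCountableTopology X] [EMetricSpace Y] [MeasurableSpace Y] [BorelSpace Y]
    {f : X → Y} {S : Set X} (hS : Measure.hausdorffMeasure 1 S = 0)
    (h : ∀ x ∈ S, ∃ K : NNReal, ∃ s ∈ nhds x, LipschitzOnWith K f s) :
    Measure.hausdorffMeasure 1 (f '' S) = 0 := by
  choose! K s hs hf using h
  obtain ⟨t, htS, htc, hcov⟩ := countable_cover_nhdsWithin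
    (fun x hx => mem_nhdsWithin_of_mem_nhds (hs x hx))
  have : f '' S ⊆ ⋃ x ∈ t, f '' (s x ∩ S) := by
    rintro _ ⟨x, hx, rfl⟩
    obtain ⟨y, hy, hxy⟩ := mem_iUnion₂.1 (hcov hx)
    exact mem_iUnion₂.2 ⟨y, hy, x, ⟨hxy, hx⟩, rfl⟩
  refine measure_mono_null this ((measure_biUnion_null_iff htc).2 fun x hx => ?_)
  have := ((hf x (htS hx)).mono (inter_subset_left (t := S))).hausdorffMeasure_image_le
    (d := 1) zero_le_one
  rw [measure_mono_null inter_subset_right hS, mul_zero] at this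
  exact le_antisymm this bot_le

end Hausdorff

/-! ### Riemannian distance, Lipschitz functions and length on a surface. -/

section General

variable {M : Type} [TopologicalSpace M] [ChartedSpace Plane M] [IsManifold 𝓘(ℝ, Plane) ∞ M]

/-- The Riemannian distance of `g`. -/
def riemannianDist [T3Space M] (g : SmoothMetric M) (x y : M) : ℝ≥0∞ :=
  letI : EMetricSpace M := riemannianEMetricSpace g
  edist x y

theorem riemannianDist_comm [T3Space M] (g : SmoothMetric M) (x y : M) :
    riemannianDist g x y = riemannianDist g y x :=
  let := riemannianEMetricSpace g
  edist_comm x y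

theorem enorm_le_of_sq_le (g : SmoothMetric M) {x : M} (v : TangentSpace 𝓘(ℝ, Plane) x)
    {K : NNReal} (h : g.inner x v v ≤ K ^ 2) :
    let : Bundle.RiemannianBundle (fun x : M => TangentSpace 𝓘(ℝ, Plane) x) :=
      ⟨g.toRiemannianMetric⟩
    ‖v‖ₑ ≤ K := by
  let : Bundle.RiemannianBundle (fun x : M => TangentSpace 𝓘(ℝ, Plane) x) :=
      ⟨g.toRiemannianMetric⟩
  have h1 : inner ℝ v v = g.inner x v v := rfl
  rw [enorm_le_coe, ← NNReal.coe_le_coe, coe_nnnorm]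
  rw [real_inner_self_eq_norm_sq] at h1
  exact le_of_sq_le_sq (by rw [h1]; exact h) K.2

/-- The distance between the endpoints of a path of speed at most `K`. -/
theorem riemannianDist_le_of_path [T3Space M] (g : SmoothMetric M) {γ : ℝ → M} {a b : ℝ}
    (hab : a ≤ b) (hγ : ContMDiffOn 𝓘(ℝ, ℝ) 𝓘(ℝ, Plane) 1 γ (Icc a b)) {K : NNReal}
    (hK : ∀ t ∈ Ioo a b, g.inner (γ t) (mfderiv 𝓘(ℝ, ℝ) 𝓘(ℝ, Plane) γ t (1 : ℝ))
      (mfderiv 𝓘(ℝ, ℝ) 𝓘(ℝ, Plane) γ t (1 : ℝ)) ≤ K ^ 2) :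
    riemannianDist g (γ a) (γ b) ≤ K * ENNReal.ofReal (b - a) := by
  let : Bundle.RiemannianBundle (fun x : M => TangentSpace 𝓘(ℝ, Plane) x) :=
    ⟨g.toRiemannianMetric⟩
  have : IsManifold 𝓘(ℝ, Plane) 1 M := IsManifold.of_le (n := ∞) (by norm_num)
  have h1 : riemannianDist g (γ a) (γ b) =
    Manifold.riemannianEDist 𝓘(ℝ, Plane) (γ a) (γ b) := rfl
  rw [h1]
  refine (Manifold.riemannianEDist_le_pathELength hγ rfl rfl hab).trans ?_
  rw [Manifold.pathELength_eq_lintegral_mfderiv_Ioo]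
  calc _ ≤ ∫⁻ _ in Ioo a b, (K : ℝ≥0∞) := by
        refine setLIntegral_mono' measurableSet_Ioo fun t ht => ?_
        exact enorm_le_of_sq_le g _ (hK t ht)
    _ = _ := by simp

/-- By the chain rule the derivative of `f ∘ γ` is at most `K` times the speed of `γ`; integrate
over the path. -/
theorem enorm_sub_le_of_path (g : SmoothMetric M) {f : M → ℝ} {W : Set M} (hW : IsOpen W)
    (hf : ContMDiffOn 𝓘(ℝ, Plane) 𝓘(ℝ, ℝ) 1 f W) {K : NNReal}
    (hK : ∀ x ∈ W, ∀ v : TangentSpace 𝓘(ℝ, Plane) x,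
      (show ℝ from mfderiv 𝓘(ℝ, Plane) 𝓘(ℝ, ℝ) f x v) ^ 2 ≤ K ^ 2 * g.inner x v v)
    {γ : ℝ → M} (hγ : ContMDiffOn 𝓘(ℝ, ℝ) 𝓘(ℝ, Plane) 1 γ (Icc 0 1)) (hγW : MapsTo γ (Icc 0 1) W) :
    let : Bundle.RiemannianBundle (fun x : M => TangentSpace 𝓘(ℝ, Plane) x) :=
      ⟨g.toRiemannianMetric⟩
    edist (f (γ 0)) (f (γ 1)) ≤ K * Manifold.pathELength 𝓘(ℝ, Plane) γ 0 1 := by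
  let : Bundle.RiemannianBundle (fun x : M => TangentSpace 𝓘(ℝ, Plane) x) :=
      ⟨g.toRiemannianMetric⟩
  have hC : ContMDiffOn 𝓘(ℝ, ℝ) 𝓘(ℝ, ℝ) 1 (f ∘ γ) (Icc 0 1) := hf.comp hγ hγW
  calc edist (f (γ 0)) (f (γ 1)) = ‖(f ∘ γ) 1 - (f ∘ γ) 0‖ₑ := by
        rw [edist_comm, edist_eq_enorm_sub]; rfl
    _ ≤ ∫⁻ t in Icc 0 1, ‖derivWithin (f ∘ γ) (Icc 0 1) t‖ₑ :=
        enorm_sub_le_lintegral_derivWithin_Icc_of_contDiffOn_Icc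
          (contMDiffOn_iff_contDiffOn.1 hC) zero_le_one
    _ ≤ ∫⁻ t in Icc 0 1, K * ‖mfderivWithin 𝓘(ℝ, ℝ) 𝓘(ℝ, Plane) γ (Icc 0 1) t (1 : ℝ)‖ₑ := by
        refine setLIntegral_mono' measurableSet_Icc fun t ht => ?_
        have hd : derivWithin (f ∘ γ) (Icc 0 1) t =
            mfderiv 𝓘(ℝ, Plane) 𝓘(ℝ, ℝ) f (γ t)
              (mfderivWithin 𝓘(ℝ, ℝ) 𝓘(ℝ, Plane) γ (Icc 0 1) t (1 : ℝ)) := by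
          have := mfderiv_comp_mfderivWithin (I := 𝓘(ℝ, ℝ)) (I' := 𝓘(ℝ, Plane)) (I'' := 𝓘(ℝ, ℝ))
            (f := γ) (g := f) (s := Icc (0:ℝ) 1) t
            (((hf (γ t) (hγW ht)).contMDiffAt (hW.mem_nhds (hγW ht))).mdifferentiableAt one_ne_zero)
            (hγ.mdifferentiableOn one_ne_zero t ht)
            (by
              rw [uniqueMDiffWithinAt_iff_uniqueDiffWithinAt]
              exact uniqueDiffOn_Icc zero_lt_one t ht)
          rw [← fderivWithin_derivWithin, ← mfderivWithin_eq_fderivWithin, this]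
          rfl
        set v := mfderivWithin 𝓘(ℝ, ℝ) 𝓘(ℝ, Plane) γ (Icc 0 1) t (1 : ℝ)
        have h2 := hK (γ t) (hγW ht) v
        rw [hd]
        have h3 : g.inner (γ t) v v = ‖v‖ ^ 2 := real_inner_self_eq_norm_sq v
        rw [h3, ← mul_pow] at h2
        have h4 := abs_le_of_sq_le_sq h2 (by positivity)
        have h5 : ‖(show ℝ from mfderiv 𝓘(ℝ, Plane) 𝓘(ℝ, ℝ) f (γ t) v)‖₊ ≤ K * ‖v‖₊ := by
          rw [← NNReal.coe_le_coe]
          exact h4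
        have h6 : (‖(show ℝ from mfderiv 𝓘(ℝ, Plane) 𝓘(ℝ, ℝ) f (γ t) v)‖ₑ) ≤ K * ‖v‖ₑ := by
          simp only [enorm]
          exact_mod_cast h5
        exact h6
    _ = K * Manifold.pathELength 𝓘(ℝ, Plane) γ 0 1 := by
        rw [lintegral_const_mul' _ _ ENNReal.coe_ne_top,
          Manifold.pathELength_eq_lintegral_mfderivWithin_Icc]
        rfl

/-- Paths from `x` to `y` of nearly minimal length are shorter than `r`. They stay in the ball of
radius `r` around `x`, hence in `W`, where the bound on the differential is available. -/
theorem edist_le_of_ball_subset [T3Space M] (g : SmoothMetric M) {f : M → ℝ} {W : Set M}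
    (hW : IsOpen W) (hf : ContMDiffOn 𝓘(ℝ, Plane) 𝓘(ℝ, ℝ) 1 f W) {K : NNReal} (hK0 : K ≠ 0)
    (hK : ∀ x ∈ W, ∀ v : TangentSpace 𝓘(ℝ, Plane) x,
      (show ℝ from mfderiv 𝓘(ℝ, Plane) 𝓘(ℝ, ℝ) f x v) ^ 2 ≤ K ^ 2 * g.inner x v v)
    {x y : M} {r : ℝ≥0∞} (hxy : riemannianDist g x y < r)
    (hr : ∀ z, riemannianDist g x z < r → z ∈ W) :
    edist (f x) (f y) ≤ K * riemannianDist g x y := by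
  let : Bundle.RiemannianBundle (fun x : M => TangentSpace 𝓘(ℝ, Plane) x) :=
    ⟨g.toRiemannianMetric⟩
  have h1 : ∀ z, riemannianDist g x z = Manifold.riemannianEDist 𝓘(ℝ, Plane) x z := fun z => rfl
  rw [mul_comm, ← ENNReal.div_le_iff (by simpa using hK0) (by simp)]
  refine le_of_forall_gt fun q hq => ?_
  have hq' := lt_min hq hxy
  rw [h1] at hq'
  obtain ⟨γ, rfl, rfl, hγ, hlt⟩ := Manifold.exists_lt_of_riemannianEDist_lt hq'
  have hmaps : MapsTo γ (Icc 0 1) W := fun t ht => by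
    refine hr _ ?_
    rw [h1]
    refine (Manifold.riemannianEDist_le_pathELength (a := 0) (b := t)
      (hγ.mono (Icc_subset_Icc_right ht.2)) rfl rfl ht.1).trans_lt ?_
    exact ((Manifold.pathELength_mono le_rfl ht.2).trans_lt hlt).trans_le (min_le_right _ _)
  have := enorm_sub_le_of_path g hW hf hK hγ hmaps
  rw [ENNReal.div_lt_iff (by simp [hK0]) (by simp)]
  refine this.trans_lt ?_
  rw [mul_comm]
  exact ENNReal.mul_lt_mul_left (by simpa using hK0) (by simp) (hlt.trans_le (min_le_left _ _))

/-- A function whose differential has norm at most `K` near `p` is `K`-Lipschitz near `p`. -/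
theorem exists_nhds_edist_le [T3Space M] (g : SmoothMetric M) {f : M → ℝ} {W : Set M}
    (hW : IsOpen W) (hf : ContMDiffOn 𝓘(ℝ, Plane) 𝓘(ℝ, ℝ) 1 f W) {K : NNReal} (hK0 : K ≠ 0)
    (hK : ∀ x ∈ W, ∀ v : TangentSpace 𝓘(ℝ, Plane) x,
      (show ℝ from mfderiv 𝓘(ℝ, Plane) 𝓘(ℝ, ℝ) f x v) ^ 2 ≤ K ^ 2 * g.inner x v v)
    {p : M} (hp : p ∈ W) :
    ∃ s ∈ nhds p, ∀ x ∈ s, ∀ y ∈ s, edist (f x) (f y) ≤ K * riemannianDist g x y := by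
  let : EMetricSpace M := riemannianEMetricSpace g
  obtain ⟨r, hr0, hr⟩ := EMetric.mem_nhds_iff.1 (hW.mem_nhds hp)
  -- Two points of the ball of radius r/3 are less than 2r/3 apart, and the ball of radius 2r/3
  -- around either of them still lies in the ball of radius r around `p`.
  refine ⟨Metric.eball p (r / 3), Metric.eball_mem_nhds p (by simpa using hr0.ne'), ?_⟩
  intro x hx y hy
  have hd : ∀ z, riemannianDist g x z = edist x z := fun z => rfl
  have h3 : r / 3 + r / 3 + r / 3 = r := ENNReal.add_thirds r
  refine edist_le_of_ball_subset g hW hf hK0 hK (r := r / 3 + r / 3) ?_ fun z hz => hr ?_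
  · rw [hd]
    exact (edist_triangle_right x y p).trans_lt (ENNReal.add_lt_add hx hy)
  · rw [hd] at hz
    rw [Metric.mem_eball, ← h3]
    exact (edist_triangle_left z p x).trans_lt (ENNReal.add_lt_add hz hx)

/-- A function whose differential has norm at most `K` is `K`-Lipschitz. -/
theorem edist_le_riemannianDist [T3Space M] (g : SmoothMetric M) {f : M → ℝ}
    (hf : ContMDiff 𝓘(ℝ, Plane) 𝓘(ℝ, ℝ) 1 f) {K : NNReal} (hK0 : K ≠ 0)
    (hK : ∀ x : M, ∀ v : TangentSpace 𝓘(ℝ, Plane) x,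
      (show ℝ from mfderiv 𝓘(ℝ, Plane) 𝓘(ℝ, ℝ) f x v) ^ 2 ≤ K ^ 2 * g.inner x v v) (x y : M) :
    edist (f x) (f y) ≤ K * riemannianDist g x y := by
  rcases eq_or_ne (riemannianDist g x y) ⊤ with ht | ht
  · simp [ht, hK0]
  exact edist_le_of_ball_subset g isOpen_univ hf.contMDiffOn hK0 (fun x _ => hK x)
    (lt_top_iff_ne_top.2 ht) fun _ _ => mem_univ _

/-- A metric carrying a proper Lipschitz function is complete. -/
theorem isCompleteMetric_of_proper [T3Space M] (g : SmoothMetric M) {f : M → ℝ} {K : NNReal}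
    (hf : ∀ x y, edist (f x) (f y) ≤ K * riemannianDist g x y)
    (hc : ∀ a, IsCompact {x | f x ≤ a}) : IsCompleteMetric g := by
  let : EMetricSpace M := riemannianEMetricSpace g
  have hL : LipschitzWith K f := hf
  refine UniformSpace.complete_of_cauchySeq_tendsto fun u hu => ?_
  have hfu : CauchySeq (f ∘ u) := hL.uniformContinuous.comp_cauchySeq hu
  obtain ⟨B, hB⟩ := hfu.isBounded_range.bddAbove
  obtain ⟨x, -, hx⟩ := cauchySeq_tendsto_of_isComplete (hc B).isComplete
    (fun n => hB ⟨n, rfl⟩) hu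
  exact ⟨x, hx⟩

/-- Upper bounds for lengths come from Lipschitz parametrizations; lower bounds come from real
functions with Lipschitz control, as in `volume_image_le_lengthMeasure`. -/
theorem lengthMeasure_image_le [T3Space M] [MeasurableSpace M] [BorelSpace M] (g : SmoothMetric M)
    {γ : ℝ → M} {K : NNReal} {s : Set ℝ}
    (hγ : ∀ a ∈ s, ∀ b ∈ s, riemannianDist g (γ a) (γ b) ≤ K * edist a b) :
    lengthMeasure g (γ '' s) ≤ K * volume s := by
  let : EMetricSpace M := riemannianEMetricSpace g
  have hL : LipschitzOnWith K γ s := fun a ha b hb => hγ a ha b hb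
  have := hL.hausdorffMeasure_image_le (d := 1) zero_le_one
  rwa [hausdorffMeasure_real, ENNReal.rpow_one] at this

theorem volume_image_le_lengthMeasure [T3Space M] [MeasurableSpace M] [BorelSpace M]
    [SecondCountableTopology M] (g : SmoothMetric M) {f : M → ℝ} {K : NNReal} {S : Set M}
    (h : ∀ p ∈ S, ∃ s ∈ nhds p, ∀ x ∈ s ∩ S, ∀ y ∈ s ∩ S,
      edist (f x) (f y) ≤ K * riemannianDist g x y) :
    volume (f '' S) ≤ K * lengthMeasure g S := by
  let : EMetricSpace M := riemannianEMetricSpace g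
  rw [← hausdorffMeasure_real]
  refine hausdorffMeasure_image_le_of_locally fun p hp => ?_
  obtain ⟨s, hs, hsf⟩ := h p hp
  exact ⟨s, hs, fun x hx y hy => hsf x hx y hy⟩

theorem volume_image_eq_zero [T3Space M] [MeasurableSpace M] [BorelSpace M]
    [SecondCountableTopology M] (g : SmoothMetric M) {f : M → ℝ} {S : Set M}
    (hS : lengthMeasure g S = 0)
    (h : ∀ p ∈ S, ∃ K : NNReal, ∃ s ∈ nhds p, ∀ x ∈ s, ∀ y ∈ s,
      edist (f x) (f y) ≤ K * riemannianDist g x y) :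
    volume (f '' S) = 0 := by
  let : EMetricSpace M := riemannianEMetricSpace g
  rw [← hausdorffMeasure_real]
  refine hausdorffMeasure_image_null_of_locally hS fun p hp => ?_
  obtain ⟨K, s, hs, hsf⟩ := h p hp
  exact ⟨K, s, hs, fun x hx y hy => hsf x hx y hy⟩

end General

/-! ### Reduction of bundle notions on an open subset of the plane to ordinary calculus. -/

section OpenSubset

variable {U : TopologicalSpace.Opens Plane}

theorem mem_chartAt_source (x y : U) : y ∈ (chartAt Plane x).source := by
  rw [TopologicalSpace.Opens.chartAt_eq]
  simp only [OpenPartialHomeomorph.subtypeRestr_source, mem_preimage]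
  exact mem_univ _

/-- The inclusion of an open subset of the plane has the identity as differential. -/
theorem hasMFDerivAt_val (x : U) :
    HasMFDerivAt 𝓘(ℝ, Plane) 𝓘(ℝ, Plane) (Subtype.val : U → Plane) x
      (ContinuousLinearMap.id ℝ Plane) := by
  refine ⟨continuous_subtype_val.continuousAt, ?_⟩
  have : writtenInExtChartAt 𝓘(ℝ, Plane) 𝓘(ℝ, Plane) x (Subtype.val : U → Plane)
      =ᶠ[nhds (x : Plane)] id := by
    filter_upwards [U.isOpen.mem_nhds x.2] with y hy
    exact congrArg Subtype.val ((chartAt Plane x).left_inv (mem_chartAt_source x ⟨y, hy⟩))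
  have h2 : extChartAt 𝓘(ℝ, Plane) x x = (x : Plane) := rfl
  rw [h2]
  exact ((hasFDerivAt_id _).congr_of_eventuallyEq this).hasFDerivWithinAt

/-- All charts of `U` are the inclusion into the plane, so the coordinate changes of the tangent
bundle are the identity. -/
theorem trivializationAt_symm_apply (x y : U) (v : Plane) :
    (trivializationAt Plane (TangentSpace 𝓘(ℝ, Plane)) x).symm y v = v := by
  have h : (trivializationAt Plane (TangentSpace 𝓘(ℝ, Plane)) x).symmL ℝ y v = v := by
    rw [TangentBundle.symmL_trivializationAt_eq_core (mem_chartAt_source x y)]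
    exact (tangentBundleCore 𝓘(ℝ, Plane) U).coordChange_self (achart Plane x) y
      (mem_chartAt_source x y) v
  rwa [Bundle.Trivialization.symmL_apply _ (mem_chartAt_source x y)] at h

/-- A field of bilinear forms that is smooth in the coordinates of the plane is a smooth section of
the bundle of bilinear forms. -/
theorem contMDiff_section
    (g : ∀ x : U, TangentSpace 𝓘(ℝ, Plane) x →L[ℝ] TangentSpace 𝓘(ℝ, Plane) x →L[ℝ] ℝ)
    {G : Plane → Plane →L[ℝ] Plane →L[ℝ] ℝ} (hG : ContDiffOn ℝ ∞ G U) (h : ∀ x, g x = G x) :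
    ContMDiff 𝓘(ℝ, Plane) (𝓘(ℝ, Plane).prod 𝓘(ℝ, Plane →L[ℝ] Plane →L[ℝ] ℝ)) ∞
      (fun x : U ↦ Bundle.TotalSpace.mk' (Plane →L[ℝ] Plane →L[ℝ] ℝ)
        (E := fun x : U => TangentSpace 𝓘(ℝ, Plane) x →L[ℝ] TangentSpace 𝓘(ℝ, Plane) x →L[ℝ] ℝ)
        x (g x)) := by
  intro x
  rw [Bundle.contMDiffAt_section]
  have h1 : ContMDiffAt 𝓘(ℝ, Plane) 𝓘(ℝ, Plane →L[ℝ] Plane →L[ℝ] ℝ) ∞ (fun x : U => G x) x :=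
    (hG.contDiffAt (U.isOpen.mem_nhds x.2)).contMDiffAt.comp x contMDiff_subtype_val.contMDiffAt
  refine h1.congr_of_eventuallyEq (Filter.Eventually.of_forall fun y => ?_)
  refine ContinuousLinearMap.ext fun v => ContinuousLinearMap.ext fun w => ?_
  dsimp only
  rw [hom_trivializationAt_apply]
  refine (inCoordinates_apply_eq₂ (x := y) (F₁ := Plane) (F₂ := Plane) (F₃ := ℝ)
    (E₃ := Bundle.Trivial U ℝ) (mem_chartAt_source x y) (mem_chartAt_source x y)
    (mem_univ _)).trans ?_
  rw [trivializationAt_symm_apply, trivializationAt_symm_apply, h]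
  simp
  rfl

theorem contMDiffAt_comp_val {f : Plane → ℝ} {x : U} (hf : ContDiffAt ℝ 1 f x) :
    ContMDiffAt 𝓘(ℝ, Plane) 𝓘(ℝ, ℝ) 1 (fun y : U => f y) x :=
  hf.contMDiffAt.comp x contMDiff_subtype_val.contMDiffAt

theorem mfderiv_comp_val_apply {f : Plane → ℝ} {x : U} {f' : Plane →L[ℝ] ℝ}
    (hf : HasFDerivAt f f' x) (v : Plane) :
    (show ℝ from mfderiv 𝓘(ℝ, Plane) 𝓘(ℝ, ℝ) (fun y : U => f y) x v) = f' v := by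
  have h := HasMFDerivAt.comp x (hf.hasMFDerivAt) (hasMFDerivAt_val x)
  have h2 := h.mfderiv
  exact congrArg (fun L : Plane →L[ℝ] ℝ => L v) h2

/-- A `C^1` function on the plane whose differential has norm at most `K` near `p` is `K`-Lipschitz
near `p`. -/
theorem exists_nhds_edist_le_of_contDiffAt (g : SmoothMetric U) {f : Plane → ℝ} {p : U}
    (hf : ContDiffAt ℝ 1 f p) {K : NNReal} (hK0 : K ≠ 0)
    (hK : ∀ᶠ x : U in nhds p, ∀ v : Plane, (fderiv ℝ f x v) ^ 2 ≤ K ^ 2 * metricAt g x v v) :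
    ∃ s ∈ nhds p, ∀ x ∈ s, ∀ y ∈ s, edist (f x) (f y) ≤ K * riemannianDist g x y := by
  have h1 : ∀ᶠ x : U in nhds p, ContDiffAt ℝ 1 f x :=
    continuous_subtype_val.continuousAt.eventually (hf.eventually (by simp))
  obtain ⟨W, hWs, hWo, hpW⟩ := eventually_nhds_iff.1 (h1.and hK)
  refine exists_nhds_edist_le g hWo
    (fun x hx => (contMDiffAt_comp_val (hWs x hx).1).contMDiffWithinAt) hK0
    (fun x hx v => ?_) hpW
  have := mfderiv_comp_val_apply ((hWs x hx).1.differentiableAt one_ne_zero).hasFDerivAt v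
  rw [this]
  exact (hWs x hx).2 v

theorem edist_le_of_contDiffAt (g : SmoothMetric U) {f : Plane → ℝ}
    (hf : ∀ x : U, ContDiffAt ℝ 1 f x) {K : NNReal} (hK0 : K ≠ 0)
    (hK : ∀ x : U, ∀ v : Plane, (fderiv ℝ f x v) ^ 2 ≤ K ^ 2 * metricAt g x v v) (x y : U) :
    edist (f x) (f y) ≤ K * riemannianDist g x y := by
  refine edist_le_riemannianDist g (f := fun x : U => f x)
    (fun x => contMDiffAt_comp_val (hf x)) hK0 (fun x v => ?_) x y
  have := mfderiv_comp_val_apply ((hf x).differentiableAt one_ne_zero).hasFDerivAt v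
  rw [this]
  exact hK x v

/-- The distance between the endpoints of a path in the plane of speed at most `K`. -/
theorem riemannianDist_le_of_contDiff (g : SmoothMetric U) {γ : ℝ → U} {a b : ℝ} (hab : a ≤ b)
    (hγ : ContDiff ℝ ∞ fun t => (γ t : Plane)) {K : NNReal}
    (hK : ∀ t, metricAt g (γ t) (deriv (fun t => (γ t : Plane)) t)
      (deriv (fun t => (γ t : Plane)) t) ≤ K ^ 2) :
    riemannianDist g (γ a) (γ b) ≤ K * ENNReal.ofReal (b - a) := by
  have hs : ContMDiff 𝓘(ℝ, ℝ) 𝓘(ℝ, Plane) 1 γ :=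
    
    ((ContMDiff.subtypeVal_comp_iff U γ).1 hγ.contMDiff).of_le (by norm_num)
  refine riemannianDist_le_of_path g hab hs.contMDiffOn fun t _ => ?_
  have h := HasMFDerivAt.comp t (hasMFDerivAt_val (γ t))
    ((hs t).mdifferentiableAt one_ne_zero).hasMFDerivAt
  have h3 : deriv (fun t => (γ t : Plane)) t =
      mfderiv 𝓘(ℝ, ℝ) 𝓘(ℝ, Plane) γ t (1 : ℝ) := by
    have h4 : ∃ L : ℝ →L[ℝ] Plane, HasFDerivAt (fun t => (γ t : Plane)) L t ∧
        L 1 = mfderiv 𝓘(ℝ, ℝ) 𝓘(ℝ, Plane) γ t (1 : ℝ) := ⟨_, h.hasFDerivAt, rfl⟩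
    obtain ⟨L, hL, h1⟩ := h4
    rw [← h1]
    exact hL.hasDerivAt.deriv
  have := hK t
  rw [h3] at this
  exact this

end OpenSubset

/-! ### Rotationally invariant metrics: smoothness, inversion, completeness. -/

/-- The cross product `x ∧ v` as a linear form in `v`. -/
def crossForm (x : Plane) : Plane →L[ℝ] ℝ :=
  x 0 • EuclideanSpace.proj (𝕜 := ℝ) 1 - x 1 • EuclideanSpace.proj (𝕜 := ℝ) 0

theorem crossForm_apply (x v : Plane) : crossForm x v = x 0 * v 1 - x 1 * v 0 := by
  simp [crossForm]

theorem plane_inner (x v : Plane) : inner ℝ x v = x 0 * v 0 + x 1 * v 1 := by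
  rw [PiLp.inner_apply, Fin.sum_univ_two]
  simp [mul_comm]

theorem plane_norm_sq (x : Plane) : ‖x‖ ^ 2 = x 0 ^ 2 + x 1 ^ 2 := by
  rw [← real_inner_self_eq_norm_sq, plane_inner]
  ring

/-- Lagrange's identity: up to the factor ‖x‖, the two forms are the radial and angular components
of `v`. -/
theorem inner_sq_add_cross_sq (x v : Plane) :
    (inner ℝ x v) ^ 2 + (crossForm x v) ^ 2 = ‖x‖ ^ 2 * ‖v‖ ^ 2 := by
  rw [plane_inner, crossForm_apply, plane_norm_sq, plane_norm_sq]
  ring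

/-- Profile functions of a rotationally invariant metric `A(t)² dt² + B(t)² dθ²`, `t = log r`. -/
structure Profile where
  A : ℝ → ℝ
  B : ℝ → ℝ
  contDiff_A : ContDiff ℝ ∞ A
  contDiff_B : ContDiff ℝ ∞ B
  A_pos : ∀ t, 0 < A t
  B_pos : ∀ t, 0 < B t

namespace Profile

variable (p : Profile)

/-- The bilinear form `A(t)² dt² + B(t)² dθ²` at a point of the plane. -/
def form (x : Plane) : Plane →L[ℝ] Plane →L[ℝ] ℝ :=
  -- Since dt = ⟨x, ·⟩/‖x‖² and dθ = (x ∧ ·)/‖x‖², both squares carry the factor ‖x‖⁻⁴.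
  (p.A (Real.log ‖x‖) ^ 2 / ‖x‖ ^ 4) • (innerSL ℝ x).smulRight (innerSL ℝ x) +
    (p.B (Real.log ‖x‖) ^ 2 / ‖x‖ ^ 4) • (crossForm x).smulRight (crossForm x)

theorem form_apply (x v w : Plane) : p.form x v w =
    p.A (Real.log ‖x‖) ^ 2 / ‖x‖ ^ 4 * (inner ℝ x v * inner ℝ x w) +
      p.B (Real.log ‖x‖) ^ 2 / ‖x‖ ^ 4 * (crossForm x v * crossForm x w) := by
  simp [form]

theorem contDiff_crossForm : ContDiff ℝ ∞ crossForm := by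
  unfold crossForm
  fun_prop

theorem contDiffOn_form : ContDiffOn ℝ ∞ p.form puncturedPlane := by
  intro x hx
  have hx0 : x ≠ 0 := hx
  have hn : ‖x‖ ≠ 0 := norm_ne_zero_iff.2 hx0
  have h1 : ContDiffAt ℝ ∞ (fun x : Plane => ‖x‖) x := contDiffAt_norm ℝ hx0
  have h2 : ContDiffAt ℝ ∞ (fun x : Plane => Real.log ‖x‖) x := h1.log hn
  have hA := (p.contDiff_A.contDiffAt.comp x h2).pow 2 |>.div (h1.pow 4) (by positivity)
  have hB := (p.contDiff_B.contDiffAt.comp x h2).pow 2 |>.div (h1.pow 4) (by positivity)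
  have h3 : ContDiffAt ℝ ∞ (fun x : Plane => innerSL ℝ x) x := (innerSL ℝ).contDiff.contDiffAt
  have h4 : ContDiffAt ℝ ∞ crossForm x := contDiff_crossForm.contDiffAt
  exact ((hA.smul (h3.smulRight h3)).add (hB.smul (h4.smulRight h4))).contDiffWithinAt

/-- Quantitative positivity: this one estimate gives definiteness, boundedness of the unit balls and
the local Lipschitz property of `C^1` functions. -/
theorem sq_norm_le {x : Plane} (hx : x ≠ 0) (v : Plane) : ‖v‖ ^ 2 ≤
    ‖x‖ ^ 2 * (1 / p.A (Real.log ‖x‖) ^ 2 + 1 / p.B (Real.log ‖x‖) ^ 2) * p.form x v v := by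
  have hn : 0 < ‖x‖ := norm_pos_iff.2 hx
  have hA := p.A_pos (Real.log ‖x‖)
  have hB := p.B_pos (Real.log ‖x‖)
  have h := inner_sq_add_cross_sq x v
  have h2 : ‖v‖ ^ 2 = (inner ℝ x v ^ 2 + crossForm x v ^ 2) / ‖x‖ ^ 2 := by
    rw [h]
    field_simp
  rw [h2, form_apply]
  set a := p.A (Real.log ‖x‖)
  set b := p.B (Real.log ‖x‖)
  have : ‖x‖ ^ 2 * (1 / a ^ 2 + 1 / b ^ 2) * (a ^ 2 / ‖x‖ ^ 4 * (inner ℝ x v * inner ℝ x v) +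
      b ^ 2 / ‖x‖ ^ 4 * (crossForm x v * crossForm x v)) =
      (inner ℝ x v ^ 2 + crossForm x v ^ 2) / ‖x‖ ^ 2 +
      (a ^ 2 / b ^ 2 * inner ℝ x v ^ 2 + b ^ 2 / a ^ 2 * crossForm x v ^ 2) / ‖x‖ ^ 2 := by
    field_simp
    ring
  rw [this]
  have : 0 ≤ (a ^ 2 / b ^ 2 * inner ℝ x v ^ 2 + b ^ 2 / a ^ 2 * crossForm x v ^ 2) / ‖x‖ ^ 2 := by
    positivity
  linarith

theorem isVonNBounded_form {x : Plane} (hx : x ≠ 0) :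
    Bornology.IsVonNBounded ℝ {v : Plane | p.form x v v < 1} := by
  refine (NormedSpace.isVonNBounded_iff ℝ).2 (isBounded_iff_forall_norm_le.2
    ⟨Real.sqrt (‖x‖ ^ 2 * (1 / p.A (Real.log ‖x‖) ^ 2 + 1 / p.B (Real.log ‖x‖) ^ 2)),
      fun v hv => Real.le_sqrt_of_sq_le ((p.sq_norm_le hx v).trans ?_)⟩)
  exact mul_le_of_le_one_right (by positivity) (le_of_lt hv)

theorem form_pos {x : Plane} (hx : x ≠ 0) {v : Plane} (hv : v ≠ 0) : 0 < p.form x v v := by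
  by_contra hneg
  have h := p.sq_norm_le hx v
  have h1 : 0 < ‖v‖ ^ 2 := by positivity
  have h2 := mul_nonpos_of_nonneg_of_nonpos
    (a := ‖x‖ ^ 2 * (1 / p.A (Real.log ‖x‖) ^ 2 + 1 / p.B (Real.log ‖x‖) ^ 2)) (by positivity)
    (not_lt.1 hneg)
  linarith

/-- The metric `A(t)² dt² + B(t)² dθ²`, `t = log r`, on the punctured plane. -/
def metric : SmoothMetric puncturedPlane where
  inner x := p.form x
  symm x v w := by
    refine (p.form_apply x v w).trans (Eq.trans ?_ (p.form_apply x w v).symm)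
    ring
  pos x v hv := p.form_pos x.2 hv
  isVonNBounded x := p.isVonNBounded_form x.2
  contMDiff := contMDiff_section _ p.contDiffOn_form fun _ => rfl

theorem metricAt_metric (x : puncturedPlane) (v w : Plane) :
    metricAt p.metric x v w = p.form x v w := rfl

end Profile

theorem norm_pos_of_punctured (x : puncturedPlane) : 0 < ‖(x : Plane)‖ := norm_pos_iff.2 x.2

theorem crossForm_self (x : Plane) : crossForm x x = 0 := by
  rw [crossForm_apply]; ring

theorem crossForm_smul_left (c : ℝ) (x v : Plane) : crossForm (c • x) v = c * crossForm x v := by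
  simp only [crossForm_apply, PiLp.smul_apply, smul_eq_mul]; ring

/-- The differential is ‖x‖⁻² times the reflection in the line orthogonal to `x`. -/
theorem fderiv_inversion_apply {x : Plane} (hx : x ≠ 0) (v : Plane) :
    fderiv ℝ (EuclideanGeometry.inversion (0 : Plane) 1) x v =
      (1 / ‖x‖ ^ 2) • (v - (2 * (inner ℝ x v / ‖x‖ ^ 2)) • x) := by
  rw [(EuclideanGeometry.hasFDerivAt_inversion (R := 1) hx).fderiv]
  simp only [sub_zero, dist_zero_right, smul_apply, one_div]
  rw [inv_pow]
  congr 1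
  have : ((ℝ ∙ x)ᗮ.reflection : Plane →L[ℝ] Plane) v = (ℝ ∙ x)ᗮ.reflection v := rfl
  rw [this, Submodule.reflection_orthogonal_apply, Submodule.reflection_singleton_apply]
  simp only [RCLike.ofReal_real_eq_id, id, two_smul, two_mul, add_smul]
  abel

namespace Profile

variable (p : Profile)

/-- Even profiles give metrics that are invariant under inversion. -/
theorem isInversionInvariant (hA : ∀ t, p.A (-t) = p.A t) (hB : ∀ t, p.B (-t) = p.B t) :
    IsInversionInvariant p.metric := by
  intro x v w
  have hr := norm_pos_of_punctured x
  have hx : (x : Plane) ≠ 0 := x.2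
  rw [metricAt_metric, metricAt_metric]
  have hinv : ((inv x : puncturedPlane) : Plane) = (1 / ‖(x : Plane)‖ ^ 2) • (x : Plane) := by
    simp [inv, EuclideanGeometry.inversion]
  rw [hinv, fderiv_inversion_apply hx, fderiv_inversion_apply hx]
  set y : Plane := x.1
  have hn : ‖(1 / ‖y‖ ^ 2) • y‖ = ‖y‖⁻¹ := by
    rw [norm_smul, Real.norm_of_nonneg (by positivity)]
    field_simp
  -- The next two identities say that inversion pulls dt back to -dt and dθ back to dθ. The sign
  -- disappears in dt².
  have hi : ∀ v : Plane, inner ℝ ((1 / ‖y‖ ^ 2) • y)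
      ((1 / ‖y‖ ^ 2) • (v - (2 * (inner ℝ y v / ‖y‖ ^ 2)) • y)) = -inner ℝ y v / ‖y‖ ^ 4 := by
    intro v
    rw [real_inner_smul_left, real_inner_smul_right, inner_sub_right, real_inner_smul_right,
      real_inner_self_eq_norm_sq]
    field_simp
    ring
  have hc : ∀ v : Plane, crossForm ((1 / ‖y‖ ^ 2) • y)
      ((1 / ‖y‖ ^ 2) • (v - (2 * (inner ℝ y v / ‖y‖ ^ 2)) • y)) = crossForm y v / ‖y‖ ^ 4 := by
    intro v
    rw [crossForm_smul_left, map_smul, map_sub, map_smul, crossForm_self, smul_eq_mul]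
    field_simp
    simp
  rw [form_apply, form_apply, hn, Real.log_inv, hA, hB, hi, hi, hc, hc]
  field_simp

/-- If `A(t) ≥ |sinh t|` then the metric is complete. -/
theorem isCompleteMetric (hA : ∀ t, Real.sinh t ^ 2 ≤ p.A t ^ 2) : IsCompleteMetric p.metric := by
  -- The function is cosh t. Its differential sinh t dt has norm at most 1 because sinh² ≤ A².
  refine isCompleteMetric_of_proper (K := 1) p.metric
    (f := fun x => (‖(x : Plane)‖ + ‖(x : Plane)‖⁻¹) / 2)
    (edist_le_of_contDiffAt p.metric (f := fun x => (‖x‖ + ‖x‖⁻¹) / 2) (fun x => ?_) one_ne_zero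
      fun x v => ?_) fun a => ?_
  · have hn := contDiffAt_norm ℝ (n := 1) (show (x : Plane) ≠ 0 from x.2)
    exact (hn.add (hn.inv (norm_pos_of_punctured x).ne')).div_const 2
  · have hr := norm_pos_of_punctured x
    have hx : (x : Plane) ≠ 0 := x.2
    have hn : HasFDerivAt (fun y : Plane => ‖y‖) (‖(x : Plane)‖⁻¹ • innerSL ℝ (x : Plane)) x := by
      have h := (hasStrictFDerivAt_norm_sq (x : Plane)).hasFDerivAt.sqrt (by positivity)
      simp only [Real.sqrt_sq (norm_nonneg _)] at h
      refine h.congr_fderiv ?_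
      ext v
      simp
      field_simp
    have hf := ((hn.add ((hasDerivAt_inv hr.ne').comp_hasFDerivAt (x : Plane) hn)).mul_const
      (2⁻¹ : ℝ)).fderiv
    have hf' : fderiv ℝ (fun x : Plane => (‖x‖ + ‖x‖⁻¹) / 2) x v =
        Real.sinh (Real.log ‖(x : Plane)‖) * inner ℝ (x : Plane) v / ‖(x : Plane)‖ ^ 2 := by
      rw [Real.sinh_log hr]
      have := congrArg (fun L => L v) hf
      simp only [Pi.add_def, Function.comp_def, ← div_eq_mul_inv] at this
      refine this.trans ?_
      simp
      field_simp
      ring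
    rw [hf', metricAt_metric, form_apply]
    have h1 := hA (Real.log ‖(x : Plane)‖)
    have h2 := mul_le_mul_of_nonneg_right h1
      (show 0 ≤ inner ℝ (x : Plane) v ^ 2 / ‖(x : Plane)‖ ^ 4 by positivity)
    have h3 : 0 ≤ p.B (Real.log ‖(x : Plane)‖) ^ 2 / ‖(x : Plane)‖ ^ 4 *
      (crossForm x v * crossForm x v) := mul_nonneg (by positivity) (mul_self_nonneg _)
    have h4 : (Real.sinh (Real.log ‖(x : Plane)‖) * inner ℝ (x : Plane) v / ‖(x : Plane)‖ ^ 2) ^ 2 =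
      Real.sinh (Real.log ‖(x : Plane)‖) ^ 2 * (inner ℝ (x : Plane) v ^ 2 / ‖(x : Plane)‖ ^ 4) := by
      field_simp
    rw [h4]
    simp only [NNReal.coe_one, one_pow, one_mul]
    refine h2.trans (le_trans (le_of_eq ?_) (le_add_of_nonneg_right h3))
    ring
  · rw [Subtype.isCompact_iff]
    -- Clearing the denominator gives an inequality that fails at the origin, so the sublevel set is
    -- closed in the whole plane.
    have himg : Subtype.val '' {x : puncturedPlane | (‖(x : Plane)‖ + ‖(x : Plane)‖⁻¹) / 2 ≤ a} =
        {x : Plane | ‖x‖ ^ 2 + 1 ≤ 2 * a * ‖x‖} := by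
      ext x
      constructor
      · rintro ⟨x, hx, rfl⟩
        have hr := norm_pos_of_punctured x
        have hx' := mul_le_mul_of_nonneg_right (show _ ≤ a from hx)
          (show 0 ≤ 2 * ‖(x : Plane)‖ by positivity)
        have h1 : (‖(x : Plane)‖ + ‖(x : Plane)‖⁻¹) / 2 * (2 * ‖(x : Plane)‖) =
          ‖(x : Plane)‖ ^ 2 + 1 := by field_simp
        rw [h1] at hx'
        simp only [mem_ofPred_eq]
        linarith
      · intro hx
        simp only [mem_ofPred_eq] at hx
        have hx0 : x ≠ 0 := by
          rintro rfl
          norm_num at hx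
        have hr : 0 < ‖x‖ := norm_pos_iff.2 hx0
        refine ⟨⟨x, hx0⟩, ?_, rfl⟩
        simp only [mem_ofPred_eq]
        have h1 : (‖x‖ + ‖x‖⁻¹) / 2 = (‖x‖ ^ 2 + 1) / (2 * ‖x‖) := by field_simp
        rw [h1, div_le_iff₀ (by positivity)]
        linarith
    rw [himg]
    refine Metric.isCompact_of_isClosed_isBounded (isClosed_le (by fun_prop) (by fun_prop))
      (isBounded_iff_forall_norm_le.2 ⟨2 * a, fun x hx => ?_⟩)
    simp only [mem_ofPred_eq] at hx
    by_contra hlt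
    have := norm_nonneg x
    nlinarith

/-- `C^1` functions are locally Lipschitz for the Riemannian distance. -/
theorem exists_locally_lipschitz {f : Plane → ℝ} {x : puncturedPlane}
    (hf : ContDiffAt ℝ 1 f x) : ∃ K : NNReal, ∃ s ∈ nhds x, ∀ y ∈ s, ∀ z ∈ s,
      edist (f y) (f z) ≤ K * riemannianDist p.metric y z := by
  have hr := norm_pos_of_punctured x
  -- By `sq_norm_le`, `q` bounds the squared norm of the differential of `f` for the metric. As q <
  -- (q + 1)² at `x`, continuity makes q(x) + 1 a Lipschitz constant near `x`.
  set q : Plane → ℝ := fun y => ‖fderiv ℝ f y‖ ^ 2 *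
    (‖y‖ ^ 2 * (1 / p.A (Real.log ‖y‖) ^ 2 + 1 / p.B (Real.log ‖y‖) ^ 2)) with hq
  have hlog : ContinuousAt (fun y : Plane => Real.log ‖y‖) (x : Plane) :=
    continuous_norm.continuousAt.log hr.ne'
  have hqc : ContinuousAt q x := by
    have h1 : ContinuousAt (fderiv ℝ f) x := (hf.fderiv_right (m := 0) (by norm_num)).continuousAt
    have hA : ContinuousAt (fun y : Plane => p.A (Real.log ‖y‖)) x :=
      p.contDiff_A.continuous.continuousAt.comp hlog
    have hB : ContinuousAt (fun y : Plane => p.B (Real.log ‖y‖)) x :=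
      p.contDiff_B.continuous.continuousAt.comp hlog
    exact (h1.norm.pow 2).mul ((continuous_norm.continuousAt.pow 2).mul
      ((continuousAt_const.div (hA.pow 2) (pow_pos (p.A_pos _) 2).ne').add
        (continuousAt_const.div (hB.pow 2) (pow_pos (p.B_pos _) 2).ne')))
  have hq0 : ∀ y, 0 ≤ q y := fun y => by positivity
  have hlt : q x < (Real.toNNReal (q x + 1) : ℝ) ^ 2 := by
    rw [Real.coe_toNNReal _ (by linarith [hq0 x])]
    nlinarith [hq0 x]
  refine ⟨Real.toNNReal (q x + 1), exists_nhds_edist_le_of_contDiffAt p.metric hf ?_ ?_⟩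
  · rw [Ne, Real.toNNReal_eq_zero]
    linarith [hq0 x]
  · filter_upwards [continuous_subtype_val.continuousAt.eventually
      (hqc.eventually (gt_mem_nhds hlt))] with y hy v
    have hpos : 0 ≤ p.form y v v := by
      rcases eq_or_ne v 0 with rfl | hv
      · simp
      · exact (p.form_pos y.2 hv).le
    calc (fderiv ℝ f y v) ^ 2 ≤ (‖fderiv ℝ f y‖ * ‖v‖) ^ 2 :=
          sq_le_sq' (by linarith [neg_abs_le (fderiv ℝ f y v), (fderiv ℝ f y).le_opNorm v,
            Real.norm_eq_abs (fderiv ℝ f y v)]) ((le_abs_self _).trans ((fderiv ℝ f y).le_opNorm v))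
      _ = ‖fderiv ℝ f y‖ ^ 2 * ‖v‖ ^ 2 := by ring
      _ ≤ ‖fderiv ℝ f y‖ ^ 2 * (‖(y : Plane)‖ ^ 2 * (1 / p.A (Real.log ‖(y : Plane)‖) ^ 2 +
          1 / p.B (Real.log ‖(y : Plane)‖) ^ 2) * p.form y v v) := by
          gcongr
          exact p.sq_norm_le y.2 v
      _ = q y * p.form y v v := by rw [hq]; ring
      _ ≤ _ := mul_le_mul_of_nonneg_right hy.le hpos

end Profile

/-! ### Polar coordinates and the length of circles. -/

/-- The plane as the complex numbers. -/
def toComplex : Plane →L[ℝ] ℂ :=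
  (EuclideanSpace.proj (𝕜 := ℝ) 0).smulRight (1 : ℂ) +
    (EuclideanSpace.proj (𝕜 := ℝ) 1).smulRight Complex.I

theorem toComplex_re (x : Plane) : (toComplex x).re = x 0 := by simp [toComplex]

theorem toComplex_im (x : Plane) : (toComplex x).im = x 1 := by simp [toComplex]

/-- The polar angle of a point of the plane. -/
def angle (x : Plane) : ℝ := (toComplex x).arg

/-- The point with polar coordinates `(r, θ)`. -/
def polar (r θ : ℝ) : Plane := !₂[r * Real.cos θ, r * Real.sin θ]

theorem norm_polar {r : ℝ} (hr : 0 ≤ r) (θ : ℝ) : ‖polar r θ‖ = r := by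
  rw [← sq_eq_sq₀ (norm_nonneg _) hr, plane_norm_sq]
  simp only [polar]
  simp
  nlinarith [Real.sin_sq_add_cos_sq θ]

theorem toComplex_polar (r θ : ℝ) :
    toComplex (polar r θ) = r * (Complex.cos θ + Complex.sin θ * Complex.I) := by
  apply Complex.ext
  · rw [toComplex_re]; simp [polar, Complex.cos_ofReal_re, Complex.sin_ofReal_re]
  · rw [toComplex_im]; simp [polar, Complex.cos_ofReal_re, Complex.sin_ofReal_re]

theorem angle_polar {r : ℝ} (hr : 0 < r) {θ : ℝ} (hθ : θ ∈ Ioc (-Real.pi) Real.pi) :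
    angle (polar r θ) = θ := by
  rw [angle, toComplex_polar, Complex.arg_mul_cos_add_sin_mul_I hr hθ]

theorem norm_toComplex (x : Plane) : ‖toComplex x‖ = ‖x‖ := by
  rw [← sq_eq_sq₀ (norm_nonneg _) (norm_nonneg _), plane_norm_sq, Complex.sq_norm,
    Complex.normSq_apply, toComplex_re, toComplex_im]
  ring

theorem polar_angle (x : Plane) : polar ‖x‖ (angle x) = x := by
  have h : toComplex (polar ‖x‖ (angle x)) = toComplex x := by
    rw [toComplex_polar, angle, ← norm_toComplex, Complex.norm_mul_cos_add_sin_mul_I]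
  ext i
  fin_cases i
  · have := congrArg Complex.re h
    rwa [toComplex_re, toComplex_re] at this
  · have := congrArg Complex.im h
    rwa [toComplex_im, toComplex_im] at this

theorem polar_mem_slitPlane {r : ℝ} (hr : 0 < r) {θ : ℝ} (hθ : θ ∈ Ioo (-Real.pi) Real.pi) :
    toComplex (polar r θ) ∈ Complex.slitPlane := by
  rw [Complex.mem_slitPlane_iff_arg]
  refine ⟨?_, ?_⟩
  · rw [← angle, angle_polar hr ⟨hθ.1, hθ.2.le⟩]
    exact hθ.2.ne
  · rw [← norm_ne_zero_iff, norm_toComplex, norm_polar hr.le]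
    exact hr.ne'

theorem angle_eq : angle = fun x => (Complex.log (toComplex x)).im :=
  funext fun _ => (Complex.log_im _).symm

theorem contDiffAt_angle {x : Plane} (hx : toComplex x ∈ Complex.slitPlane) :
    ContDiffAt ℝ 1 angle x := by
  have h1 : ContDiffAt ℝ 1 (fun x => Complex.log (toComplex x)) x :=
    ((Complex.contDiffAt_log hx).restrict_scalars ℝ).comp x toComplex.contDiff.contDiffAt
  rw [angle_eq]
  exact Complex.imCLM.contDiff.contDiffAt.comp x h1

/-- The angle is Im log z, and its differential is Im(dz/z). -/
theorem fderiv_angle {x : Plane} (hx : toComplex x ∈ Complex.slitPlane) (v : Plane) :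
    fderiv ℝ angle x v = crossForm x v / ‖x‖ ^ 2 := by
  have h1 : HasFDerivAt (fun x => Complex.log (toComplex x))
      ((toComplex x)⁻¹ • toComplex) x :=
    (Complex.hasStrictDerivAt_log hx).hasDerivAt.comp_hasFDerivAt x toComplex.hasFDerivAt
  have h2 : HasFDerivAt angle (Complex.imCLM.comp ((toComplex x)⁻¹ • toComplex)) x := by
    rw [angle_eq]
    exact Complex.imCLM.hasFDerivAt.comp x h1
  rw [h2.fderiv, crossForm_apply, plane_norm_sq]
  simp [Complex.normSq_apply, toComplex_re, toComplex_im]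
  ring

theorem contDiff_polar (r : ℝ) : ContDiff ℝ ∞ (polar r) := by
  rw [contDiff_euclidean]
  intro i
  fin_cases i
  · exact contDiff_const.mul Real.contDiff_cos
  · exact contDiff_const.mul Real.contDiff_sin

theorem deriv_polar (r θ : ℝ) :
    deriv (polar r) θ = !₂[-(r * Real.sin θ), r * Real.cos θ] := by
  have h1 : polar r = fun θ => Real.cos θ • !₂[r, 0] + Real.sin θ • !₂[0, r] := by
    funext θ
    ext i
    fin_cases i <;> simp [polar, mul_comm]
  rw [h1]
  refine (((Real.hasDerivAt_cos θ).smul_const _).add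
    ((Real.hasDerivAt_sin θ).smul_const _)).deriv.trans ?_
  ext i
  fin_cases i <;> simp [mul_comm]

/-- The point with polar coordinates `(r, θ)`, `r > 0`, of the punctured plane. -/
def polarPoint {r : ℝ} (hr : 0 < r) (θ : ℝ) : puncturedPlane :=
  ⟨polar r θ, fun h => hr.ne' ((norm_polar hr.le θ).symm.trans (norm_eq_zero.2 h))⟩

/-- The circle of Euclidean radius `r`. -/
def circle (r : ℝ) : Set puncturedPlane := {x | ‖(x : Plane)‖ = r}

namespace Profile

variable (p : Profile)

theorem riemannianDist_polarPoint_le {r : ℝ} (hr : 0 < r) (a b : ℝ) :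
    riemannianDist p.metric (polarPoint hr a) (polarPoint hr b) ≤
      (p.B (Real.log r)).toNNReal * edist a b := by
  wlog hab : a ≤ b generalizing a b
  · rw [riemannianDist_comm, edist_comm]
    exact this b a (le_of_not_ge hab)
  have h1 : edist a b = ENNReal.ofReal (b - a) := by
    rw [edist_comm, edist_dist, Real.dist_eq, abs_of_nonneg (sub_nonneg.2 hab)]
  rw [h1]
  refine riemannianDist_le_of_contDiff p.metric hab (contDiff_polar r) fun t => ?_
  rw [metricAt_metric, form_apply]
  have hd : deriv (fun t => ((polarPoint hr t : puncturedPlane) : Plane)) t =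
    !₂[-(r * Real.sin t), r * Real.cos t] := deriv_polar r t
  have hv : ((polarPoint hr t : puncturedPlane) : Plane) = polar r t := rfl
  rw [hd, hv, norm_polar hr.le, Real.coe_toNNReal _ (p.B_pos _).le]
  have hi : inner ℝ (polar r t) !₂[-(r * Real.sin t), r * Real.cos t] = 0 := by
    rw [plane_inner]
    simp [polar]
    ring
  have hc : crossForm (polar r t) !₂[-(r * Real.sin t), r * Real.cos t] = r ^ 2 := by
    rw [crossForm_apply]
    simp [polar]
    nlinarith [Real.sin_sq_add_cos_sq t]
  rw [hi, hc]
  apply le_of_eq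
  field_simp
  ring

theorem lengthMeasure_circle_le {r : ℝ} (hr : 0 < r) :
    lengthMeasure p.metric (circle r) ≤ ENNReal.ofReal (2 * Real.pi * p.B (Real.log r)) := by
  have hsub : circle r ⊆ polarPoint hr '' Ioc (-Real.pi) Real.pi := by
    intro x hx
    have hx' : ‖(x : Plane)‖ = r := hx
    refine ⟨angle x, Complex.arg_mem_Ioc _, Subtype.ext ?_⟩
    change polar r (angle x) = x
    rw [← hx', polar_angle]
  refine (measure_mono hsub).trans ((lengthMeasure_image_le p.metric
    fun a _ b _ => p.riemannianDist_polarPoint_le hr a b).trans (le_of_eq ?_))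
  rw [Real.volume_Ioc]
  change ENNReal.ofReal _ * _ = _
  rw [← ENNReal.ofReal_mul (p.B_pos _).le]
  congr 1
  ring

/-- Off the negative axis the angle maps the circle onto (-π, π), and its differential has norm 1/B.
A constant K > 1/B is needed because the bound must hold on a neighbourhood, where 1/B may be
larger; at the end K tends to 1/B. -/
theorem le_lengthMeasure_circle {r : ℝ} (hr : 0 < r) :
    ENNReal.ofReal (2 * Real.pi * p.B (Real.log r)) ≤ lengthMeasure p.metric (circle r) := by
  set b := p.B (Real.log r) with hb
  have hb0 : 0 < b := p.B_pos _
  have key : ∀ K : NNReal, b⁻¹ < K →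
      ENNReal.ofReal (2 * Real.pi) ≤ K * lengthMeasure p.metric (circle r) := by
    intro K hK
    have hK0 : (0 : ℝ) < K := (inv_pos.2 hb0).trans hK
    set S : Set puncturedPlane := circle r ∩ {x | toComplex x ∈ Complex.slitPlane}
    have himg : Ioo (-Real.pi) Real.pi ⊆ (fun x : puncturedPlane => angle x) '' S := by
      intro θ hθ
      exact ⟨polarPoint hr θ, ⟨norm_polar hr.le θ, polar_mem_slitPlane hr hθ⟩,
        angle_polar hr ⟨hθ.1, hθ.2.le⟩⟩
    have hvol : volume ((fun x : puncturedPlane => angle x) '' S) ≤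
        K * lengthMeasure p.metric S := by
      refine volume_image_le_lengthMeasure p.metric fun x hx => ?_
      have hxr : ‖(x : Plane)‖ = r := hx.1
      have hx2 : toComplex x ∈ Complex.slitPlane := hx.2
      obtain ⟨s, hs, hsf⟩ := exists_nhds_edist_le_of_contDiffAt p.metric (contDiffAt_angle hx2)
        (K := K) (by exact_mod_cast hK0.ne') (by
          have h1 : ∀ᶠ y : puncturedPlane in nhds x, toComplex y ∈ Complex.slitPlane :=
            (toComplex.continuous.comp continuous_subtype_val).continuousAt.eventually
              (Complex.isOpen_slitPlane.mem_nhds hx2)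
          have hc : ContinuousAt (fun y : puncturedPlane => (p.B (Real.log ‖(y : Plane)‖))⁻¹) x :=
            (p.contDiff_B.continuous.continuousAt.comp
              ((continuous_norm.comp continuous_subtype_val).continuousAt.log
                (norm_pos_iff.2 x.2).ne')).inv₀ (p.B_pos _).ne'
          have h2 : ∀ᶠ y : puncturedPlane in nhds x, (p.B (Real.log ‖(y : Plane)‖))⁻¹ < K :=
            hc.eventually (gt_mem_nhds (by dsimp only; rw [hxr]; exact hK))
          filter_upwards [h1, h2] with y hy1 hy2 v
          have hy0 : 0 < ‖(y : Plane)‖ := norm_pos_iff.2 y.2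
          have hB := p.B_pos (Real.log ‖(y : Plane)‖)
          rw [fderiv_angle hy1, metricAt_metric, form_apply]
          set B := p.B (Real.log ‖(y : Plane)‖)
          have h3 : 1 ≤ K * B := by
            rw [inv_lt_iff_one_lt_mul₀ hB] at hy2
            exact hy2.le
          have h4 : 1 ≤ (K * B) ^ 2 := one_le_pow₀ h3
          calc (crossForm y v / ‖(y : Plane)‖ ^ 2) ^ 2
              ≤ (K * B) ^ 2 * (crossForm y v / ‖(y : Plane)‖ ^ 2) ^ 2 :=
                le_mul_of_one_le_left (sq_nonneg _) h4
            _ = K ^ 2 * (B ^ 2 / ‖(y : Plane)‖ ^ 4 * (crossForm y v * crossForm y v)) := by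
                field_simp
            _ ≤ _ := by
                gcongr
                refine le_add_of_nonneg_left (mul_nonneg (by positivity) (mul_self_nonneg _)))
      exact ⟨s, hs, fun y hy z hz => hsf y hy.1 z hz.1⟩
    calc ENNReal.ofReal (2 * Real.pi) = volume (Ioo (-Real.pi) Real.pi) := by
          rw [Real.volume_Ioo]
          congr 1
          ring
      _ ≤ K * lengthMeasure p.metric S := (measure_mono himg).trans hvol
      _ ≤ K * lengthMeasure p.metric (circle r) := by
          gcongr
          exact inter_subset_left
  have hfin : lengthMeasure p.metric (circle r) ≠ ⊤ :=
    ((p.lengthMeasure_circle_le hr).trans_lt ENNReal.ofReal_lt_top).ne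
  lift lengthMeasure p.metric (circle r) to NNReal using hfin with L hL
  rw [ENNReal.ofReal_le_iff_le_toReal ENNReal.coe_ne_top, ENNReal.coe_toReal]
  have key' : ∀ k : ℝ, b⁻¹ < k → 2 * Real.pi ≤ k * L := by
    intro k hk
    have hk0 : 0 < k := (inv_pos.2 hb0).trans hk
    have := key k.toNNReal (by rwa [Real.coe_toNNReal _ hk0.le])
    rw [← ENNReal.coe_mul, ENNReal.ofReal_le_iff_le_toReal ENNReal.coe_ne_top,
      ENNReal.coe_toReal, NNReal.coe_mul, Real.coe_toNNReal _ hk0.le] at this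
    exact this
  have hlim : 2 * Real.pi ≤ b⁻¹ * L :=
    ge_of_tendsto (x := nhdsWithin b⁻¹ (Ioi b⁻¹)) (f := fun k : ℝ => k * L)
      (((continuous_id.mul continuous_const).tendsto _).mono_left nhdsWithin_le_nhds)
      (by filter_upwards [self_mem_nhdsWithin] with k hk using key' k hk)
  rw [inv_mul_eq_div, le_div_iff₀ hb0] at hlim
  exact hlim

/-- The length of the circle of Euclidean radius `r` is `2πB(log r)`. -/
theorem lengthMeasure_circle {r : ℝ} (hr : 0 < r) :
    lengthMeasure p.metric (circle r) = ENNReal.ofReal (2 * Real.pi * p.B (Real.log r)) :=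
  le_antisymm (p.lengthMeasure_circle_le hr) (p.le_lengthMeasure_circle hr)

end Profile

/-! ### Area of rotationally invariant sets. -/

/-- Integration of radial functions on the plane in polar coordinates. -/
theorem lintegral_fun_norm_plane {f : ℝ → ℝ≥0∞} (hf : Measurable f) :
    ∫⁻ x : Plane, f ‖x‖ =
      ENNReal.ofReal (2 * Real.pi) * ∫⁻ r in Ioi (0 : ℝ), ENNReal.ofReal r * f r := by
  have hdim : Module.finrank ℝ Plane - 1 = 1 := by simp
  calc ∫⁻ x : Plane, f ‖x‖
      = ∫⁻ x : ({(0)}ᶜ : Set Plane), f ‖x.1‖ ∂((volume : Measure Plane).comap (↑)) := by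
        rw [lintegral_subtype_comap (measurableSet_singleton _).compl fun x => f ‖x‖,
          restrict_compl_singleton]
    _ = ∫⁻ x, f x.2 ∂((volume : Measure Plane).toSphere.prod
          (Measure.volumeIoiPow (Module.finrank ℝ Plane - 1))) := by
        rw [← ((volume : Measure Plane).measurePreserving_homeomorphUnitSphereProd).lintegral_comp_emb
          (Homeomorph.measurableEmbedding _)]
        simp only [homeomorphUnitSphereProd_apply_snd_coe]
    _ = (volume : Measure Plane).toSphere univ *
          ∫⁻ r : Ioi (0 : ℝ), f r ∂(Measure.volumeIoiPow 1) := by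
        rw [hdim, lintegral_prod _ (by fun_prop)]
        simp [mul_comm]
    _ = _ := by
        congr 1
        · rw [Measure.toSphere_apply_univ, EuclideanSpace.volume_ball_fin_two]
          simp only [finrank_euclideanSpace, Fintype.card_fin, Nat.cast_ofNat]
          rw [ENNReal.ofReal_mul (by norm_num)]
          simp
        · rw [Measure.volumeIoiPow, lintegral_withDensity_eq_lintegral_mul _ (by fun_prop)
            (by fun_prop), ← lintegral_subtype_comap measurableSet_Ioi]
          simp

/-- Substitution r = exp t: r dr = exp(2t) dt cancels the denominator, which comes from the factor
r⁻² in the Cartesian area density AB/r². -/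
theorem lintegral_Ioi_comp_log {D : ℝ → ℝ} (I : Set ℝ) :
    ∫⁻ r in Ioi (0 : ℝ), ENNReal.ofReal r *
      I.indicator (fun t => ENNReal.ofReal (D t / Real.exp t ^ 2)) (Real.log r) =
    ∫⁻ t, I.indicator (fun t => ENNReal.ofReal (D t)) t := by
  rw [← Real.range_exp, ← image_univ, lintegral_image_eq_lintegral_abs_deriv_mul MeasurableSet.univ
    (fun x _ => (Real.hasDerivAt_exp x).hasDerivWithinAt) Real.exp_injective.injOn,
    Measure.restrict_univ]
  refine lintegral_congr fun t => ?_
  rw [Real.log_exp, abs_of_pos (Real.exp_pos t)]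
  by_cases ht : t ∈ I
  · rw [indicator_of_mem ht, indicator_of_mem ht, ← ENNReal.ofReal_mul (Real.exp_pos t).le,
      ← ENNReal.ofReal_mul (Real.exp_pos t).le]
    congr 1
    field_simp
  · simp [ht]

/-- The area measure has a density with respect to Lebesgue measure. -/
theorem areaMeasure_absolutelyContinuous {U : TopologicalSpace.Opens Plane} (g : SmoothMetric U) :
    areaMeasure g ≪ Measure.comap (Subtype.val : U → Plane) volume :=
  withDensity_absolutelyContinuous _ _

theorem areaMeasure_eq_zero {U : TopologicalSpace.Opens Plane} (g : SmoothMetric U) {S : Set U}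
    (hS : volume (Subtype.val '' S : Set Plane) = 0) : areaMeasure g S = 0 := by
  refine areaMeasure_absolutelyContinuous g ?_
  have := (MeasurableEmbedding.subtype_coe U.isOpen.measurableSet).comap_apply
    (volume : Measure Plane) S
  exact this.trans hS

namespace Profile

variable (p : Profile)

theorem sqrt_det_gramMatrix (x : puncturedPlane) :
    Real.sqrt (gramMatrix p.metric x).det =
      p.A (Real.log ‖(x : Plane)‖) * p.B (Real.log ‖(x : Plane)‖) / ‖(x : Plane)‖ ^ 2 := by
  have hr : 0 < ‖(x : Plane)‖ := norm_pos_iff.2 x.2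
  have hA := p.A_pos (Real.log ‖(x : Plane)‖)
  have hB := p.B_pos (Real.log ‖(x : Plane)‖)
  rw [Real.sqrt_eq_iff_mul_self_eq_of_pos (by positivity), Matrix.det_fin_two]
  simp only [gramMatrix, Matrix.of_apply, metricAt_metric, form_apply, plane_inner, crossForm_apply]
  simp
  set a := p.A (Real.log ‖(x : Plane)‖)
  set b := p.B (Real.log ‖(x : Plane)‖)
  have h : ‖(x : Plane)‖ ^ 4 = ((x : Plane) 0 ^ 2 + (x : Plane) 1 ^ 2) ^ 2 := by
    rw [← plane_norm_sq]; ring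
  field_simp
  rw [h]
  ring

/-- The area of rotationally invariant sets. -/
theorem areaMeasure_radial {I : Set ℝ} (hI : MeasurableSet I) :
    areaMeasure p.metric {x | Real.log ‖(x : Plane)‖ ∈ I} =
      ENNReal.ofReal (2 * Real.pi) * ∫⁻ t in I, ENNReal.ofReal (p.A t * p.B t) := by
  have hD : Measurable fun t => p.A t * p.B t :=
    (p.contDiff_A.continuous.mul p.contDiff_B.continuous).measurable
  set F : ℝ → ℝ≥0∞ := fun r =>
    I.indicator (fun t => ENNReal.ofReal (p.A t * p.B t / Real.exp t ^ 2)) (Real.log r) with hF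
  have hFm : Measurable F := by
    have h0 : Measurable (I.indicator fun t => ENNReal.ofReal (p.A t * p.B t / Real.exp t ^ 2)) :=
      Measurable.indicator (by fun_prop) hI
    exact h0.comp Real.measurable_log
  set S : Set puncturedPlane := {x : puncturedPlane | Real.log ‖(x : Plane)‖ ∈ I} with hSdef
  have hS : MeasurableSet S :=
    (Real.measurable_log.comp (measurable_norm.comp measurable_subtype_coe)) hI
  rw [areaMeasure, withDensity_apply _ hS, ← lintegral_indicator hS]
  have h1 : ∀ x : puncturedPlane, S.indicator
      (fun x => ENNReal.ofReal (Real.sqrt (gramMatrix p.metric x).det)) x = F ‖(x : Plane)‖ := by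
    intro x
    have hr : 0 < ‖(x : Plane)‖ := norm_pos_iff.2 x.2
    by_cases hx : Real.log ‖(x : Plane)‖ ∈ I
    · simp only [hF]
      rw [indicator_of_mem hx, indicator_of_mem (show x ∈ S from hx),
        sqrt_det_gramMatrix, Real.exp_log hr]
    · simp only [hF]
      rw [indicator_of_notMem hx, indicator_of_notMem (show x ∉ S from hx)]
  rw [lintegral_congr h1]
  have h2 : ∫⁻ x : puncturedPlane, F ‖(x : Plane)‖ ∂(Measure.comap Subtype.val volume) =
      ∫⁻ x : Plane, F ‖x‖ := by
    refine (lintegral_subtype_comap (measurableSet_singleton (0 : Plane)).compl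
      fun x => F ‖x‖).trans ?_
    rw [restrict_compl_singleton]
  rw [h2, lintegral_fun_norm_plane hFm, lintegral_Ioi_comp_log, lintegral_indicator hI]

end Profile

/-! ### Sets whose boundary has zero length. -/

/-- A set that contains no boundary points of `A` along an interval of parameters does not cross
from `A` to its complement. -/
theorem mem_interior_of_path {X : Type*} [TopologicalSpace X] {A : Set X} {γ : ℝ → X} {I : Set ℝ}
    (hI : I.OrdConnected) (hγ : ContinuousOn γ I) (h : ∀ t ∈ I, γ t ∉ frontier A) {a b : ℝ}
    (ha : a ∈ I) (hb : b ∈ I) (hA : γ a ∈ interior A) : γ b ∈ interior A := by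
  have hpre : IsPreconnected (γ '' I) := hI.isPreconnected.image γ hγ
  by_contra hbn
  have hsub : γ '' I ⊆ interior A ∪ (closure A)ᶜ := by
    rintro _ ⟨t, ht, rfl⟩
    by_contra hn
    rw [mem_union, not_or] at hn
    exact h t ht ⟨not_not.1 hn.2, hn.1⟩
  have hbc : γ b ∈ (closure A)ᶜ := (hsub ⟨b, hb, rfl⟩).resolve_left hbn
  obtain ⟨x, -, hx, hxc⟩ := hpre _ _ isOpen_interior isClosed_closure.isOpen_compl hsub
    ⟨γ a, ⟨a, ha, rfl⟩, hA⟩ ⟨γ b, ⟨b, hb, rfl⟩, hbc⟩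
  exact hxc (subset_closure (interior_subset hx))

theorem exists_mem_Ioo_notMem_of_volume_eq_zero {N : Set ℝ} (hN : volume N = 0) {a b : ℝ}
    (hab : a < b) : ∃ t ∈ Ioo a b, t ∉ N := by
  by_contra! h
  have := measure_mono_null (μ := volume) h hN
  rw [Real.volume_Ioo, ENNReal.ofReal_eq_zero] at this
  linarith

theorem continuous_polarPoint {r : ℝ} (hr : 0 < r) : Continuous (polarPoint hr) :=
  (contDiff_polar r).continuous.subtype_mk _

/-- The ray of angle `θ`, with logarithmic parameter. -/
def ray (θ s : ℝ) : puncturedPlane := polarPoint (Real.exp_pos s) θ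

theorem ray_log (θ : ℝ) {s : ℝ} (hs : 0 < s) : ray θ (Real.log s) = polarPoint hs θ :=
  Subtype.ext (by simp only [ray, polarPoint, Real.exp_log hs])

theorem continuous_ray (θ : ℝ) : Continuous (ray θ) := by
  refine Continuous.subtype_mk (f := fun s => polar (Real.exp s) θ) ?_ _
  have : (fun s => polar (Real.exp s) θ) = fun s => Real.exp s • polar 1 θ := by
    funext s
    ext i
    fin_cases i <;> simp [polar]
  rw [this]
  fun_prop

/-- Every nonempty open subset of the punctured plane contains a small arc of a circle around the
origin, off the negative axis. -/
theorem exists_arc {O : Set puncturedPlane} (hO : IsOpen O) (hne : O.Nonempty) :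
    ∃ (r : ℝ) (hr : 0 < r) (a b : ℝ), a < b ∧ Ioo a b ⊆ Ioo (-Real.pi) Real.pi ∧
      ∀ θ ∈ Ioo a b, polarPoint hr θ ∈ O := by
  obtain ⟨x, hx⟩ := hne
  have hr : 0 < ‖(x : Plane)‖ := norm_pos_iff.2 x.2
  have hpt : polarPoint hr (angle x) = x := Subtype.ext (polar_angle _)
  have hmem : angle x ∈ polarPoint hr ⁻¹' O := by rwa [mem_preimage, hpt]
  obtain ⟨δ, hδ, hball⟩ := Metric.isOpen_iff.1 (hO.preimage (continuous_polarPoint hr)) _ hmem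
  have hang : angle x ∈ Ioc (-Real.pi) Real.pi := Complex.arg_mem_Ioc _
  refine ⟨‖(x : Plane)‖, hr, max (-Real.pi) (angle x - δ), angle x,
    max_lt hang.1 (by linarith), fun θ hθ => ⟨(le_max_left _ _).trans_lt hθ.1, hθ.2.trans_le hang.2⟩,
    fun θ hθ => hball ?_⟩
  rw [Metric.mem_ball, Real.dist_eq, abs_lt]
  have := (le_max_right _ _).trans_lt hθ.1
  exact ⟨by linarith, by linarith [hθ.2]⟩

namespace Profile

variable (p : Profile)

/-- The first coordinate is locally Lipschitz, so it maps `S` to a null set of reals, and `S` lies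
over that set in the plane. -/
theorem areaMeasure_eq_zero_of_lengthMeasure_eq_zero {S : Set puncturedPlane}
    (hS : lengthMeasure p.metric S = 0) : areaMeasure p.metric S = 0 := by
  refine areaMeasure_eq_zero _ ?_
  have h0 : volume ((fun x : puncturedPlane => (x : Plane) 0) '' S) = 0 :=
    volume_image_eq_zero p.metric hS fun x _ => p.exists_locally_lipschitz (f := fun x => x 0)
      (EuclideanSpace.proj (𝕜 := ℝ) (0 : Fin 2)).contDiff.contDiffAt
  have hq : Measure.QuasiMeasurePreserving (fun x : Plane => x 0) volume volume :=
    (Measure.quasiMeasurePreserving_eval (fun _ : Fin 2 => (volume : Measure ℝ)) 0).comp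
      (PiLp.volume_preserving_ofLp (Fin 2)).quasiMeasurePreserving
  refine measure_mono_null ?_ (hq.preimage_null h0)
  rintro _ ⟨x, hx, rfl⟩
  exact ⟨x, hx, rfl⟩

/-- A set whose boundary has zero length, or its complement, has zero area. -/
theorem areaMeasure_eq_zero_of_frontier {A : Set puncturedPlane}
    (hA : lengthMeasure p.metric (frontier A) = 0) :
    areaMeasure p.metric A = 0 ∨ areaMeasure p.metric Aᶜ = 0 := by
  by_contra! hne
  have hfr := p.areaMeasure_eq_zero_of_lengthMeasure_eq_zero hA
  -- A set with empty interior is contained in its boundary, which has zero area.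
  have hint : ∀ B : Set puncturedPlane, frontier B = frontier A → areaMeasure p.metric B ≠ 0 →
      (interior B).Nonempty := by
    intro B hB hB0
    by_contra hemp
    rw [not_nonempty_iff_eq_empty] at hemp
    refine hB0 (measure_mono_null ?_ hfr)
    rw [← hB, frontier, hemp, sdiff_empty]
    exact subset_closure
  obtain ⟨r₁, hr₁, a₁, b₁, hab₁, hπ₁, harc₁⟩ := exists_arc isOpen_interior (hint A rfl hne.1)
  obtain ⟨r₂, hr₂, a₂, b₂, hab₂, hπ₂, harc₂⟩ :=
    exists_arc isOpen_interior (hint Aᶜ (frontier_compl A) hne.2)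
  -- Radii and angles of boundary points form null sets, so a circle and two rays through the given
  -- open arcs can be chosen off the boundary. Points of the negative axis are left out, where the
  -- angle is discontinuous.
  have hN : volume ((fun x : puncturedPlane => ‖(x : Plane)‖) '' frontier A) = 0 :=
    volume_image_eq_zero p.metric hA fun x _ =>
      p.exists_locally_lipschitz (contDiffAt_norm ℝ x.2)
  have hT : volume ((fun x : puncturedPlane => angle x) ''
      (frontier A ∩ {x | toComplex x ∈ Complex.slitPlane})) = 0 :=
    volume_image_eq_zero p.metric (measure_mono_null inter_subset_left hA) fun x hx =>
      p.exists_locally_lipschitz (contDiffAt_angle hx.2)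
  obtain ⟨θ₁, hθ₁, hn₁⟩ := exists_mem_Ioo_notMem_of_volume_eq_zero hT hab₁
  obtain ⟨θ₂, hθ₂, hn₂⟩ := exists_mem_Ioo_notMem_of_volume_eq_zero hT hab₂
  obtain ⟨r, hr, hn⟩ := exists_mem_Ioo_notMem_of_volume_eq_zero hN zero_lt_one
  have hr0 := hr.1
  -- Radial legs of the path: an interior point on a good ray can be moved to the circle of radius
  -- `r`. The circular leg is `h3`.
  have hradial : ∀ B : Set puncturedPlane, frontier B = frontier A → ∀ θ ∈ Ioo (-Real.pi) Real.pi,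
      θ ∉ (fun x : puncturedPlane => angle x) ''
        (frontier A ∩ {x | toComplex x ∈ Complex.slitPlane}) →
      ∀ s (hs : 0 < s), polarPoint hs θ ∈ interior B → polarPoint hr0 θ ∈ interior B := by
    intro B hB θ hθ hnθ s hs hmem
    rw [← ray_log] at hmem ⊢
    refine mem_interior_of_path ordConnected_univ (continuous_ray θ).continuousOn (fun t _ ht => ?_)
      (mem_univ _) (mem_univ _) hmem
    rw [hB] at ht
    exact hnθ ⟨ray θ t, ⟨ht, polar_mem_slitPlane (Real.exp_pos t) hθ⟩,
      angle_polar (Real.exp_pos t) ⟨hθ.1, hθ.2.le⟩⟩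
  have h1 := hradial A rfl θ₁ (hπ₁ hθ₁) hn₁ r₁ hr₁ (harc₁ θ₁ hθ₁)
  have h2 := hradial Aᶜ (frontier_compl A) θ₂ (hπ₂ hθ₂) hn₂ r₂ hr₂ (harc₂ θ₂ hθ₂)
  have h3 : polarPoint hr0 θ₂ ∈ interior A :=
    mem_interior_of_path ordConnected_univ (continuous_polarPoint hr0).continuousOn
      (fun t _ ht => hn ⟨_, ht, norm_polar hr0.le t⟩) (mem_univ _) (mem_univ _) h1
  exact interior_subset h2 (interior_subset h3)

/-- If the Cheeger constant vanishes and the total area is finite, there is no Cheeger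
minimizer. -/
theorem not_isCheegerMinimizer (hc : cheegerConstant p.metric = 0)
    (hfin : areaMeasure p.metric univ ≠ ⊤) (A : Set puncturedPlane) :
    ¬ IsCheegerMinimizer p.metric A := by
  rintro ⟨hm, h0, hhalf, hr⟩
  have hAfin : areaMeasure p.metric A ≠ ⊤ := measure_ne_top_of_subset (subset_univ _) hfin
  rw [hc, isoperimetricRatio, ENNReal.div_eq_zero_iff, or_iff_left hAfin] at hr
  rcases p.areaMeasure_eq_zero_of_frontier hr with h | h
  · exact h0.ne' h
  · have hle : areaMeasure p.metric univ ≤ areaMeasure p.metric A := by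
      rw [← union_compl_self A]
      exact (measure_union_le _ _).trans (by rw [h, add_zero])
    have hu0 : areaMeasure p.metric univ ≠ 0 := (h0.trans_le (measure_mono (subset_univ _))).ne'
    exact absurd (hle.trans hhalf) (not_le.2 (ENNReal.half_lt_self hu0 hfin))

end Profile

/-! ### Construction of the profile functions. -/

theorem integral_exp_neg_abs_eq_two : ∫ t : ℝ, Real.exp (-|t|) = 2 := by
  rw [integral_comp_abs (f := fun t => Real.exp (-t)), integral_exp_neg_Ioi_zero, mul_one]

theorem integrable_exp_neg_abs : Integrable fun t : ℝ => Real.exp (-|t|) :=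
  Integrable.of_integral_ne_zero (by rw [integral_exp_neg_abs_eq_two]; norm_num)

/-- The factor `h` vanishes near 0 and removes the only singularity, the kink of |t|. -/
theorem contDiff_mul_comp_abs {f h : ℝ → ℝ} (hf : ContDiff ℝ ∞ f) (hh : ContDiff ℝ ∞ h)
    (h0 : ∀ᶠ t in nhds 0, h t = 0) : ContDiff ℝ ∞ fun t => h t * f |t| := by
  rw [contDiff_iff_contDiffAt]
  intro t
  rcases eq_or_ne t 0 with rfl | ht
  · refine (contDiffAt_const (c := (0 : ℝ))).congr_of_eventuallyEq ?_
    filter_upwards [h0] with s hs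
    rw [hs, zero_mul]
  · exact hh.contDiffAt.mul (hf.contDiffAt.comp t (contDiffAt_abs ht))

/-- Even profile functions that agree with those of `dr² + r⁻⁴ dθ²` for `t ≥ T`, with prescribed
total area. -/
theorem exists_profile {T : ℝ} (hT : 0 < T) : ∃ p : Profile,
    (∀ t, p.A (-t) = p.A t) ∧ (∀ t, p.B (-t) = p.B t) ∧
    (∀ t, T ≤ t → p.A t = Real.exp t) ∧ (∀ t, T ≤ t → p.B t = Real.exp (-2 * t)) ∧
    (∀ t, Real.sinh t ^ 2 ≤ p.A t ^ 2) ∧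
    ∫⁻ t, ENNReal.ofReal (p.A t * p.B t) = 2 := by
  -- β is 1 for |t| ≤ T/2 and 0 for |t| ≥ T.
  let β : ContDiffBump (0 : ℝ) := ⟨T / 2, T, by linarith, by linarith⟩
  have hβ0 : ∀ t, 0 ≤ β t := fun t => β.nonneg
  have hβ1 : ∀ t, β t ≤ 1 := fun t => β.le_one
  have hβT : ∀ t, T ≤ t → β t = 0 := fun t ht => β.zero_of_le_dist (by
    rw [Real.dist_eq, sub_zero]
    exact ht.trans (le_abs_self t))
  have hβnhds : ∀ᶠ t in nhds (0 : ℝ), 1 - β t = 0 := by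
    filter_upwards [β.eventuallyEq_one] with t ht
    rw [ht]
    simp
  have hβneg : ∀ t, β (-t) = β t := fun t => β.neg t
  have hβs : ContDiff ℝ ∞ β := β.contDiff
  have hβi : Integrable β := β.integrable
  have hβpos : 0 < ∫ t, β t := β.integral_pos
  have hβec : Continuous fun t => β t * Real.exp (-|t|) := by
    have := β.continuous
    fun_prop
  have hβsupp : HasCompactSupport fun t => β t * Real.exp (-|t|) := β.hasCompactSupport.mul_right
  have hβe : Integrable fun t => β t * Real.exp (-|t|) :=
    hβec.integrable_of_hasCompactSupport hβsupp
  have hepos : 0 < ∫ t, β t * Real.exp (-|t|) := by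
    refine hβec.integral_pos_of_hasCompactSupport_nonneg_nonzero hβsupp
      (fun t => mul_nonneg (hβ0 t) (Real.exp_pos _).le) (x := 0) ?_
    rw [← sub_eq_zero.1 hβnhds.self_of_nhds]
    simp
  -- The β-weighted mean of exp(-|t|): replacing β exp(-|t|) by βc leaves the integral unchanged.
  set c : ℝ := (∫ t, β t * Real.exp (-|t|)) / ∫ t, β t with hc
  have hc0 : 0 < c := div_pos hepos hβpos
  -- A interpolates between exp |t| and cosh t, both at least cosh t. C is the area density AB, so B
  -- is recovered as C/A.
  set A : ℝ → ℝ := fun t => (1 - β t) * Real.exp |t| + β t * Real.cosh t with hA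
  set C : ℝ → ℝ := fun t => (1 - β t) * Real.exp (-|t|) + β t * c with hC
  have hA1 : ∀ t, Real.cosh t ≤ A t := by
    intro t
    have h1 : Real.cosh t ≤ Real.exp |t| := by
      rw [← Real.cosh_abs, Real.cosh_eq]
      have : Real.exp (-|t|) ≤ Real.exp |t| := Real.exp_le_exp.2 (by linarith [abs_nonneg t])
      linarith
    have := mul_le_mul_of_nonneg_left h1 (sub_nonneg.2 (hβ1 t))
    simp only [hA]
    linarith
  have hApos : ∀ t, 0 < A t := fun t => (Real.cosh_pos t).trans_le (hA1 t)
  have hCpos : ∀ t, 0 < C t := by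
    intro t
    simp only [hC]
    rcases (hβ0 t).eq_or_lt with h | h
    · rw [← h]
      simp [Real.exp_pos]
    · have := sub_nonneg.2 (hβ1 t)
      positivity
  have hAs : ContDiff ℝ ∞ A :=
    (contDiff_mul_comp_abs Real.contDiff_exp (contDiff_const.sub hβs) hβnhds).add
      (hβs.mul Real.contDiff_cosh)
  have hCs : ContDiff ℝ ∞ C :=
    (contDiff_mul_comp_abs (f := fun t => Real.exp (-t)) (by fun_prop)
      (contDiff_const.sub hβs) hβnhds).add (hβs.mul contDiff_const)
  have hAT : ∀ t, T ≤ t → A t = Real.exp t := fun t ht => by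
    simp only [hA]
    rw [hβT t ht, abs_of_nonneg (hT.le.trans ht)]
    ring
  have hCT : ∀ t, T ≤ t → C t = Real.exp (-t) := fun t ht => by
    simp only [hC]
    rw [hβT t ht, abs_of_nonneg (hT.le.trans ht)]
    ring
  have hAneg : ∀ t, A (-t) = A t := fun t => by
    simp only [hA]
    rw [hβneg, abs_neg, Real.cosh_neg]
  have hCneg : ∀ t, C (-t) = C t := fun t => by
    simp only [hC]
    rw [hβneg, abs_neg]
  refine ⟨⟨A, fun t => C t / A t, hAs, hCs.div hAs fun t => (hApos t).ne', hApos,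
    fun t => div_pos (hCpos t) (hApos t)⟩, hAneg, fun t => ?_, hAT, fun t ht => ?_, fun t => ?_, ?_⟩
  · simp only [hAneg, hCneg]
  · simp only [hAT t ht, hCT t ht]
    rw [← Real.exp_sub]
    congr 1
    ring
  · have h1 : Real.cosh t ^ 2 ≤ A t ^ 2 := pow_le_pow_left₀ (Real.cosh_pos t).le (hA1 t) 2
    have h2 := Real.cosh_sq t
    simp only
    linarith
  · have hAC : ∀ t, A t * (C t / A t) = C t := fun t => mul_div_cancel₀ _ (hApos t).ne'
    simp only [hAC]
    have hCe : C = fun t => Real.exp (-|t|) - β t * Real.exp (-|t|) + β t * c := by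
      funext t
      simp only [hC]
      ring
    have hint : Integrable C := by
      rw [hCe]
      exact (integrable_exp_neg_abs.sub hβe).add (hβi.mul_const c)
    rw [← ofReal_integral_eq_lintegral_ofReal hint (Filter.Eventually.of_forall fun t => (hCpos t).le)]
    have : ∫ t, C t = 2 := by
      have h1 := integral_add (integrable_exp_neg_abs.sub hβe) (hβi.mul_const c)
      have h2 := integral_sub integrable_exp_neg_abs hβe
      simp only [Pi.sub_apply] at h1
      rw [hCe, h1, h2, integral_mul_const, integral_exp_neg_abs_eq_two, hc,
        mul_div_cancel₀ _ hβpos.ne', sub_add_cancel]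
    rw [this]
    simp

/-! ### Exteriors of circles as competitors for the Cheeger constant. -/

theorem isClosed_exterior (r : ℝ) : IsClosed (exterior r) :=
  isClosed_le continuous_const (continuous_norm.comp continuous_subtype_val)

theorem frontier_exterior {r : ℝ} (hr : 0 < r) : frontier (exterior r) = circle r := by
  apply Subset.antisymm
  · have := frontier_le_subset_eq (continuous_const (y := r))
      (continuous_norm.comp (continuous_subtype_val (p := (· ∈ puncturedPlane))))
    exact fun x hx => (this hx).symm
  · intro x hx
    have hx' : ‖(x : Plane)‖ = r := hx
    rw [(isClosed_exterior r).frontier_eq]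
    refine ⟨hx'.ge, fun hint => ?_⟩
    have hpt : ray (angle x) (Real.log r) = x := Subtype.ext (by
      rw [ray_log _ hr]
      change polar r (angle x) = x
      nth_rewrite 1 [← hx']
      exact polar_angle _)
    -- An interior point could be moved slightly inwards along its ray, where the norm drops below
    -- `r`.
    have hmem : ∀ᶠ s in nhds (Real.log r), ray (angle x) s ∈ interior (exterior r) :=
      (continuous_ray (angle x)).continuousAt.eventually
        (isOpen_interior.mem_nhds (by rwa [hpt]))
    obtain ⟨s, hs, hlt⟩ := ((hmem.filter_mono nhdsWithin_le_nhds).and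
      (self_mem_nhdsWithin (s := Iio (Real.log r)))).exists
    have hle : r ≤ ‖((ray (angle x) s : puncturedPlane) : Plane)‖ :=
      show ray (angle x) s ∈ exterior r from interior_subset hs
    rw [show ‖((ray (angle x) s : puncturedPlane) : Plane)‖ = Real.exp s from
      norm_polar (Real.exp_pos s).le _] at hle
    exact hle.not_gt ((Real.lt_log_iff_exp_lt hr).1 hlt)

theorem exp_neg_two_mul_log {r : ℝ} (hr : 0 < r) : Real.exp (-2 * Real.log r) = (r ^ 2)⁻¹ := by
  rw [neg_mul, Real.exp_neg, two_mul, Real.exp_add, Real.exp_log hr, sq]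

theorem isSmoothDomain_exterior {r : ℝ} (hr : 0 < r) : IsSmoothDomain (exterior r) := by
  refine ⟨isClosed_exterior r, fun p _ => ⟨univ, fun x => r ^ 2 - ‖x‖ ^ 2, isOpen_univ, mem_univ _,
    (contDiff_const.sub (contDiff_norm_sq ℝ)).contDiffOn, fun h => ?_, fun x _ => ?_⟩⟩
  · have h1 := ((hasStrictFDerivAt_norm_sq (p : Plane)).hasFDerivAt.const_sub (r ^ 2)).fderiv
    rw [h] at h1
    -- Evaluated in the radial direction `p`, the differential is -2‖p‖², which is not 0.
    have h2 := congrArg (fun L : Plane →L[ℝ] ℝ => L (p : Plane)) h1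
    simp at h2
    exact p.2 h2
  · rw [sub_nonpos, sq_le_sq₀ hr.le (norm_nonneg _)]
    rfl

theorem exterior_eq {r : ℝ} (hr : 0 < r) :
    exterior r = {x : puncturedPlane | Real.log ‖(x : Plane)‖ ∈ Ici (Real.log r)} := by
  ext x
  exact (Real.log_le_log_iff hr (norm_pos_iff.2 x.2)).symm

namespace Profile

variable (p : Profile)

theorem areaMeasure_univ : areaMeasure p.metric univ =
    ENNReal.ofReal (2 * Real.pi) * ∫⁻ t, ENNReal.ofReal (p.A t * p.B t) := by
  have := p.areaMeasure_radial MeasurableSet.univ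
  simpa using this

theorem areaMeasure_exterior {r : ℝ} (hr : 0 < r) : areaMeasure p.metric (exterior r) =
    ENNReal.ofReal (2 * Real.pi) *
      ∫⁻ t in Ici (Real.log r), ENNReal.ofReal (p.A t * p.B t) := by
  rw [exterior_eq hr, p.areaMeasure_radial measurableSet_Ici]

theorem areaMeasure_exterior_pos {r : ℝ} (hr : 0 < r) :
    0 < areaMeasure p.metric (exterior r) := by
  rw [p.areaMeasure_exterior hr]
  have hD : Measurable fun t => ENNReal.ofReal (p.A t * p.B t) :=
    (p.contDiff_A.continuous.mul p.contDiff_B.continuous).measurable.ennreal_ofReal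
  refine ENNReal.mul_pos (by simp [Real.pi_pos]) ((setLIntegral_pos_iff hD).2 ?_).ne'
  have : Function.support (fun t => ENNReal.ofReal (p.A t * p.B t)) = univ := by
    ext t
    simp [mul_pos (p.A_pos t) (p.B_pos t)]
  rw [this, univ_inter]
  simp

/-- The reflection t ↦ -t gives a second region of the same area, disjoint from the first because
log r > 0. -/
theorem areaMeasure_exterior_le_half (hA : ∀ t, p.A (-t) = p.A t) (hB : ∀ t, p.B (-t) = p.B t)
    {r : ℝ} (hr : 1 < r) :
    areaMeasure p.metric (exterior r) ≤ areaMeasure p.metric univ / 2 := by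
  rw [p.areaMeasure_exterior (zero_lt_one.trans hr), areaMeasure_univ, mul_div_assoc]
  gcongr
  rw [ENNReal.le_div_iff_mul_le (by simp) (by simp), mul_two]
  set s := Real.log r
  have hs : 0 < s := Real.log_pos hr
  have hrefl : ∫⁻ t in Ici s, ENNReal.ofReal (p.A t * p.B t) =
      ∫⁻ t in Iic (-s), ENNReal.ofReal (p.A t * p.B t) := by
    have := (Measure.measurePreserving_neg (volume : Measure ℝ)).setLIntegral_comp_preimage_emb
      (MeasurableEquiv.neg ℝ).measurableEmbedding
      (fun t => ENNReal.ofReal (p.A t * p.B t)) (Iic (-s))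
    rw [← this]
    simp [hA, hB]
  nth_rewrite 2 [hrefl]
  rw [← lintegral_union measurableSet_Iic]
  · exact setLIntegral_le_lintegral _ _
  · exact (Iic_disjoint_Ici.2 (by linarith)).symm

theorem areaMeasure_exterior_of_le {T : ℝ} (hA : ∀ t, T ≤ t → p.A t = Real.exp t)
    (hB : ∀ t, T ≤ t → p.B t = Real.exp (-2 * t)) {r : ℝ} (hr : 0 < r) (hT : T ≤ Real.log r) :
    areaMeasure p.metric (exterior r) = ENNReal.ofReal (2 * Real.pi / r) := by
  rw [p.areaMeasure_exterior hr, setLIntegral_congr_fun (g := fun t => ENNReal.ofReal (Real.exp (-t)))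
    measurableSet_Ici (fun t ht => ?_), setLIntegral_congr Ioi_ae_eq_Ici.symm,
    ← ofReal_integral_eq_lintegral_ofReal (integrableOn_exp_neg_Ioi _)
      (Filter.Eventually.of_forall fun t => (Real.exp_pos _).le), integral_exp_neg_Ioi,
    ← ENNReal.ofReal_mul (by positivity), Real.exp_neg, Real.exp_log hr]
  · rfl
  · have ht' : T ≤ t := hT.trans ht
    simp only
    rw [hA t ht', hB t ht', ← Real.exp_add]
    congr 2
    ring

end Profile

theorem modelMetric_eq (p : Profile) {T : ℝ} (hA : ∀ t, T ≤ t → p.A t = Real.exp t)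
    (hB : ∀ t, T ≤ t → p.B t = Real.exp (-2 * t)) {x : puncturedPlane}
    (hT : T ≤ Real.log ‖(x : Plane)‖) (v w : Plane) :
    metricAt p.metric x v w = modelMetric x v w := by
  have hr : 0 < ‖(x : Plane)‖ := norm_pos_iff.2 x.2
  rw [p.metricAt_metric, p.form_apply, hA _ hT, hB _ hT, exp_neg_two_mul_log hr, Real.exp_log hr, modelMetric, formDr,
    formDr, formDtheta, formDtheta, crossForm_apply, crossForm_apply]
  field_simp

end Cheeger

end

theorem mainTheorem8 (ε : ℝ) (hε : 0 < ε) :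
    ∃ g : Cheeger.SmoothMetric Cheeger.puncturedPlane,
      (∀ x : Cheeger.puncturedPlane, 1 + ε ≤ ‖(x : Cheeger.Plane)‖ →
        ∀ v w : Cheeger.Plane, Cheeger.metricAt g x v w = Cheeger.modelMetric x v w) ∧
      Cheeger.IsInversionInvariant g ∧
      Cheeger.IsCompleteMetric g ∧
      Cheeger.areaMeasure g univ = ENNReal.ofReal (4 * Real.pi) ∧
      (∀ r : ℝ, 1 < r → Cheeger.IsSmoothCandidate g (Cheeger.exterior r)) ∧
      (∀ r : ℝ, 1 + ε ≤ r →
        Cheeger.isoperimetricRatio g (Cheeger.exterior r) = ENNReal.ofReal (1 / r)) ∧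
      Cheeger.cheegerConstant g = 0 ∧
      ¬ ∃ A : Set Cheeger.puncturedPlane, Cheeger.IsCheegerMinimizer g A := by
  have h1ε : 0 < 1 + ε := by linarith
  obtain ⟨p, hAn, hBn, hA, hB, hsinh, htot⟩ :=
    Cheeger.exists_profile (Real.log_pos (show 1 < 1 + ε by linarith))
  have huniv : Cheeger.areaMeasure p.metric univ = ENNReal.ofReal (4 * Real.pi) := by
    rw [p.areaMeasure_univ, htot, ← ENNReal.ofReal_ofNat, ← ENNReal.ofReal_mul (by positivity)]
    congr 1
    ring
  have hcand : ∀ r : ℝ, 1 < r → Cheeger.IsSmoothCandidate p.metric (Cheeger.exterior r) :=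
    fun r hr => ⟨Cheeger.isSmoothDomain_exterior (by linarith),
      p.areaMeasure_exterior_pos (by linarith), p.areaMeasure_exterior_le_half hAn hBn hr⟩
  have hratio : ∀ r : ℝ, 1 + ε ≤ r →
      Cheeger.isoperimetricRatio p.metric (Cheeger.exterior r) = ENNReal.ofReal (1 / r) := by
    intro r hr
    have hr0 : 0 < r := by linarith
    have hT : Real.log (1 + ε) ≤ Real.log r := Real.log_le_log h1ε hr
    rw [Cheeger.isoperimetricRatio, Cheeger.frontier_exterior hr0, p.lengthMeasure_circle hr0,
      p.areaMeasure_exterior_of_le hA hB hr0 hT, hB _ hT,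
      ← ENNReal.ofReal_div_of_pos (by positivity), Cheeger.exp_neg_two_mul_log hr0]
    congr 1
    field_simp
  have hcheeger : Cheeger.cheegerConstant p.metric = 0 := by
    refine le_antisymm (ENNReal.le_of_forall_pos_le_add fun δ hδ _ => ?_) bot_le
    have hδ' : (0 : ℝ) < δ := hδ
    -- Radius at least 1 + ε for the ratio formula, and at least 1/δ to make the ratio at most δ.
    refine (iInf₂_le (Cheeger.exterior (max (1 + ε) (1 / δ)))
      (hcand _ (lt_of_lt_of_le (by linarith) (le_max_left _ _)))).trans ?_
    rw [hratio _ (le_max_left _ _), zero_add]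
    refine ENNReal.ofReal_le_of_le_toReal ?_
    rw [ENNReal.coe_toReal]
    exact (one_div_le (h1ε.trans_le (le_max_left _ _)) hδ').2 (le_max_right _ _)
  refine ⟨p.metric, fun x hx v w => Cheeger.modelMetric_eq p hA hB (Real.log_le_log h1ε hx) v w,
    p.isInversionInvariant hAn hBn, p.isCompleteMetric hsinh, huniv, hcand, hratio, hcheeger, ?_⟩
  rintro ⟨A, hAmin⟩
  exact p.not_isCheegerMinimizer hcheeger (by rw [huniv]; exact ENNReal.ofReal_ne_top) A hAmin
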